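/- Call a function $\rho:\mathbb R\to(0,\infty)$ with $\int\rho=1$ and $\log\rho\in C^2(\mathbb R)$ an $(\alpha,\beta)$-target, where $\alpha>0$, if $\alpha\le-(\log\rho)''(\theta)\le\beta$ for all $\theta\in\mathbb R$ (so $\rho$ is $\alpha$-strongly log-concave and $\beta$-smooth). The one-dimensional Gaussian approximate Fisher–Rao gradient flow for $\rho$ is the ODE system $$\dot m=C\,\mathbb E_{\mathcal N(m,C)}[(\log\rho)'],\qquad \dot C=C+C\,\mathbb E_{\mathcal N(m,C)}[(\log\rho)'']\,C ,\qquad (m,C)\in\mathbb R\times(0,\infty).$$ (i) For every $(\alpha,\beta)$-target $\rho$ there is a unique minimizer $(m_\star,C_\star)$ of $\mathrm{KL}[\mathcal N(m,C)\,\|\,\rho]$ over $m\in\mathbb R$, $C>0$. The right-hand side of the flow is differentiable in $(m,C)$ at $(m_\star,C_\star)$, its Jacobian matrix there has only real eigenvalues, and the largest eigenvalue $\lambda_{\star,\max}$ (minus which is, by definition, the local convergence rate) satisfies $\lambda_{\star,\max}<0$ and $$-\lambda_{\star,\max}\ \ge\ \frac{1}{\bigl(7+\frac4{\sqrt\pi}\bigr)\bigl(1+\log\frac\beta\alpha\bigr)}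 .$$ (ii) The bound is sharp up to constants: there are numbers $0<\alpha_n<\beta_n$, $\gamma_n>0$, $\sigma_n>0$ and $(\alpha_n,\beta_n)$-targets $\rho_n$ with smoothed-bump Hessians $$-(\log\rho_n)''(\theta)=\int_{\mathbb R} H_n(x)\,\frac{e^{-(\theta-x)^2/(2\sigma_n^2)}}{\sigma_n\sqrt{2\pi}}\,dx,\qquad H_n(x)=\begin{cases}\beta_n,&\gamma_n-\sigma_n<x<\gamma_n+\sigma_n,\\ \alpha_n,&\text{otherwise,}\end{cases}$$ such that $\sigma_n\to0$, $\beta_n/\alpha_n\to\infty$, and the corresponding largest Jacobian eigenvalues $\lambda_{\star,\max,n}$ satisfy $$-\lambda_{\star,\max,n}=\mathcal O\!\left(\frac{1}{\log(\beta_n/\alpha_n)}\right)\qquad(n\to\infty).$$ -/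

import Mathlib

open MeasureTheory ProbabilityTheory Filter

/-- `ρ` is a positive probability density on the real line whose logarithm is `C²`, and which is
`α`-strongly log-concave and `β`-smooth: `α ≤ -(log ρ)'' ≤ β`, with `α > 0`. -/
structure IsLogConcaveTarget (ρ : ℝ → ℝ) (α β : ℝ) : Prop where
  pos : ∀ θ, 0 < ρ θ
  integral_eq_one : ∫ θ, ρ θ = 1
  contDiff_log : ContDiff ℝ 2 (fun θ => Real.log (ρ θ))
  alpha_pos : 0 < α
  strongly_logconcave : ∀ θ, α ≤ -deriv (deriv (fun x => Real.log (ρ x))) θ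
  smooth : ∀ θ, -deriv (deriv (fun x => Real.log (ρ x))) θ ≤ β

/-- The parameter space of (nondegenerate) Gaussians: pairs (mean, variance), variance positive. -/
def gaussianParams : Set (ℝ × ℝ) := {a | 0 < a.2}

/-- The Gaussian `N(m, C)` with `a = (m, C)`. -/
noncomputable def gaussianOf (a : ℝ × ℝ) : Measure ℝ := gaussianReal a.1 a.2.toNNReal

/-- The probability measure with Lebesgue density `ρ`. -/
noncomputable def targetMeasure (ρ : ℝ → ℝ) : Measure ℝ :=
  volume.withDensity (fun θ => ENNReal.ofReal (ρ θ))

/-- `a = (m, C)` minimizes `KL[N(m, C) ‖ ρ]` over all nondegenerate Gaussians. -/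
def IsGaussianVIMinimizer (ρ : ℝ → ℝ) (a : ℝ × ℝ) : Prop :=
  a ∈ gaussianParams ∧
    IsMinOn (fun b => InformationTheory.klDiv (gaussianOf b) (targetMeasure ρ)) gaussianParams a

/-- The right-hand side of the Gaussian approximate Fisher-Rao gradient flow,
`dm/dt = C E[(log ρ)']`, `dC/dt = C + C E[(log ρ)''] C`, expectations under `N(m, C)`. -/
noncomputable def fisherRaoField (ρ : ℝ → ℝ) (a : ℝ × ℝ) : ℝ × ℝ :=
  (a.2 * ∫ θ, deriv (fun x => Real.log (ρ x)) θ ∂(gaussianOf a),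
   a.2 + a.2 * (∫ θ, deriv (deriv (fun x => Real.log (ρ x))) θ ∂(gaussianOf a)) * a.2)

/-- The Jacobian of the flow's right-hand side with respect to `(m, C)` at the point `a`. -/
noncomputable def fisherRaoJacobian (ρ : ℝ → ℝ) (a : ℝ × ℝ) : Module.End ℝ (ℝ × ℝ) :=
  (fderiv ℝ (fisherRaoField ρ) a).toLinearMap

/-- The flow can be linearized at `a`, all eigenvalues of the Jacobian there are real, and `l` is
the largest of them. -/
def IsTopJacobianEigenvalue (ρ : ℝ → ℝ) (a : ℝ × ℝ) (l : ℝ) : Prop :=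
  DifferentiableAt ℝ (fisherRaoField ρ) a ∧
    (fisherRaoJacobian ρ a).charpoly.Splits ∧
    IsGreatest {μ : ℝ | (fisherRaoJacobian ρ a).HasEigenvalue μ} l

/-- The bump equal to `β` on `(γ - σ, γ + σ)` and to `α` elsewhere, convolved with the density of
`N(0, σ²)`. -/
noncomputable def smoothedBump (α β γ σ θ : ℝ) : ℝ :=
  ∫ x, (if γ - σ < x ∧ x < γ + σ then β else α) *
    (Real.exp (-(θ - x) ^ 2 / (2 * σ ^ 2)) / (σ * Real.sqrt (2 * Real.pi)))

/-! Write `W = -(log ρ)''`. Gaussian integration by parts turns the gradient of the KL divergence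
into expectations of `(log ρ)'` and `(log ρ)''`, so a minimizer satisfies `E[(log ρ)'] = 0` and `C *
E[W] = 1`. Conversely, transporting one Gaussian to another by an affine map and using the strong
concavity of `log ρ` shows that a stationary point is the unique minimizer; existence follows from
coercivity.

Put `S = E[W (θ - m)^2]` and `T = E[W (θ - m)]`. At the minimizer the Jacobian has rows `(-1, -T/2)`
and `(-C T, -(1 + S)/2)`. The product of its off-diagonal entries is nonnegative, so its eigenvalues
are real. Its trace is `-(3 + S)/2` and its determinant is `(1 + V)/2`, where `V = S - C T^2`. Since
`C * W` is a probability density relative to the Gaussian, `C * V` is a variance and `V ≥ 0`. Both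
eigenvalues are therefore negative, and the rate lies between `(1 + V)/(3 + S)` and twice that
(`exists_top_eigenvalue`, `exists_isTopJacobianEigenvalue`).

For the lower bound it remains to see that `S ≤ 4 + 4 log (β/α)`. This is Young's inequality for the
entropy: the density `C * W` is at most `β/α`, and `exp ((θ - m)^2/(4C))` has Gaussian mean `√2`
(`weighted_second_moment_le`).

For sharpness, `S` must be of order `log (β/α)` while `V` stays bounded, so nearly all the weight
should sit near one distant point `γ`. Prescribe the minimizer `N(0, 1)`, take `σ = 1/γ` and `α =
1/γ^2`, and let `E[W] = 1` determine `β`. The bump has Gaussian mass of order at least `σ exp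
(-γ^2/2)`, so `log (β/α) = O(γ^2)`, whereas `S` is at least of order `γ^2` and `V` is bounded
(`exists_bump_target`). -/

/-! ### Functions of exponential growth and their Gaussian integrability. -/

/-- A measurable function on the line of at most exponential growth. -/
structure ExpGrowth (g : ℝ → ℝ) : Prop where
  measurable : Measurable g
  bound : ∃ A c : ℝ, 0 ≤ A ∧ 0 ≤ c ∧ ∀ x, |g x| ≤ A * Real.exp (c * |x|)

namespace ExpGrowth

theorem mono {f g : ℝ → ℝ} (hg : ExpGrowth g) (hf : Measurable f) (h : ∀ x, |f x| ≤ |g x|) :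
    ExpGrowth f := by
  obtain ⟨A, c, hA, hc, hb⟩ := hg.bound
  exact ⟨hf, A, c, hA, hc, fun x => (h x).trans (hb x)⟩

theorem const (k : ℝ) : ExpGrowth (fun _ => k) :=
  ⟨measurable_const, |k|, 0, abs_nonneg k, le_rfl, fun x => by simp⟩

theorem id : ExpGrowth (fun x => x) :=
  ⟨measurable_id, 1, 1, zero_le_one, zero_le_one, fun x => by
    have := Real.add_one_le_exp |x|
    simp only [one_mul]
    linarith⟩

theorem add {f g : ℝ → ℝ} (hf : ExpGrowth f) (hg : ExpGrowth g) :
    ExpGrowth (fun x => f x + g x) := by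
  obtain ⟨A, c, hA, hc, hb⟩ := hf.bound
  obtain ⟨B, d, hB, hd, hb'⟩ := hg.bound
  refine ⟨hf.measurable.add hg.measurable, A + B, c + d, by positivity, by positivity, fun x => ?_⟩
  have h1 : Real.exp (c * |x|) ≤ Real.exp ((c + d) * |x|) :=
    Real.exp_le_exp.2 (mul_le_mul_of_nonneg_right (by linarith) (abs_nonneg x))
  have h2 : Real.exp (d * |x|) ≤ Real.exp ((c + d) * |x|) :=
    Real.exp_le_exp.2 (mul_le_mul_of_nonneg_right (by linarith) (abs_nonneg x))
  have h3 := mul_le_mul_of_nonneg_left h1 hA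
  have h4 := mul_le_mul_of_nonneg_left h2 hB
  have h5 := abs_add_le (f x) (g x)
  linarith [hb x, hb' x]

theorem mul {f g : ℝ → ℝ} (hf : ExpGrowth f) (hg : ExpGrowth g) :
    ExpGrowth (fun x => f x * g x) := by
  obtain ⟨A, c, hA, hc, hb⟩ := hf.bound
  obtain ⟨B, d, hB, hd, hb'⟩ := hg.bound
  refine ⟨hf.measurable.mul hg.measurable, A * B, c + d, by positivity, by positivity, fun x => ?_⟩
  rw [abs_mul, add_mul, Real.exp_add, mul_mul_mul_comm]
  exact mul_le_mul (hb x) (hb' x) (abs_nonneg _) (by positivity)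

theorem neg {f : ℝ → ℝ} (hf : ExpGrowth f) : ExpGrowth (fun x => -f x) :=
  hf.mono hf.measurable.neg fun _ => (abs_neg _).le

theorem sub {f g : ℝ → ℝ} (hf : ExpGrowth f) (hg : ExpGrowth g) :
    ExpGrowth (fun x => f x - g x) := by
  simpa only [sub_eq_add_neg] using hf.add hg.neg

theorem const_mul {f : ℝ → ℝ} (k : ℝ) (hf : ExpGrowth f) : ExpGrowth (fun x => k * f x) :=
  (const k).mul hf

theorem div_const {f : ℝ → ℝ} (hf : ExpGrowth f) (k : ℝ) : ExpGrowth (fun x => f x / k) := by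
  simpa only [div_eq_mul_inv] using hf.mul (const k⁻¹)

theorem pow {f : ℝ → ℝ} (hf : ExpGrowth f) (n : ℕ) : ExpGrowth (fun x => f x ^ n) := by
  induction n with
  | zero => simpa using const 1
  | succ n ih => simpa only [pow_succ] using ih.mul hf

theorem abs {f : ℝ → ℝ} (hf : ExpGrowth f) : ExpGrowth (fun x => |f x|) :=
  hf.mono hf.measurable.abs fun x => by simp

theorem sub_const (m : ℝ) : ExpGrowth (fun x => x - m) := id.sub (const m)

theorem comp_affine {f : ℝ → ℝ} (hf : ExpGrowth f) (p q : ℝ) :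
    ExpGrowth (fun x => f (p + q * x)) := by
  obtain ⟨A, c, hA, hc, hb⟩ := hf.bound
  refine ⟨hf.measurable.comp (by fun_prop), A * Real.exp (c * |p|), c * |q|, by positivity,
    by positivity, fun x => (hb _).trans ?_⟩
  rw [mul_assoc, ← Real.exp_add]
  refine mul_le_mul_of_nonneg_left (Real.exp_le_exp.2 ?_) hA
  calc c * |p + q * x| ≤ c * (|p| + |q * x|) := mul_le_mul_of_nonneg_left (abs_add_le _ _) hc
    _ = c * |p| + c * |q| * |x| := by rw [abs_mul]; ring

theorem integrable {g : ℝ → ℝ} (hg : ExpGrowth g) (m : ℝ) (v : NNReal) :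
    Integrable g (gaussianReal m v) := by
  obtain ⟨A, c, hA, hc, hb⟩ := hg.bound
  have h := integrable_exp_mul_abs (X := fun x : ℝ => x)
    (integrable_exp_mul_gaussianReal (μ := m) (v := v) c)
    (integrable_exp_mul_gaussianReal (μ := m) (v := v) (-c))
  exact (h.const_mul A).mono' hg.measurable.aestronglyMeasurable (ae_of_all _ hb)

/-- A function with a derivative of exponential growth has exponential growth. -/
theorem of_hasDerivAt {f f' : ℝ → ℝ} (h : ∀ x, HasDerivAt f (f' x) x) (hf' : ExpGrowth f') :
    ExpGrowth f := by
  obtain ⟨A, c, hA, hc, hb⟩ := hf'.bound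
  have hcont : Continuous f := continuous_iff_continuousAt.2 fun x => (h x).continuousAt
  have hbd : ExpGrowth fun x => |f 0| + A * Real.exp (c * |x|) * |x| := by
    refine (const _).add (ExpGrowth.mul ⟨by fun_prop, A, c, hA, hc, fun x => ?_⟩ id.abs)
    rw [abs_of_nonneg (by positivity)]
  refine hbd.mono hcont.measurable fun x => ?_
  -- Mean value inequality on the segment from `0` to `x`, where `|y| ≤ |x|` makes the derivative
  -- bound uniform.
  have hmv := (convex_uIcc (0 : ℝ) x).norm_image_sub_le_of_norm_hasDerivWithin_le
    (f := f) (f' := f') (C := A * Real.exp (c * |x|))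
    (fun y _ => (h y).hasDerivWithinAt)
    (fun y hy => (hb y).trans <| mul_le_mul_of_nonneg_left (Real.exp_le_exp.2 <|
      mul_le_mul_of_nonneg_left (by
        simpa using Set.abs_sub_left_of_mem_uIcc hy) hc) hA)
    Set.left_mem_uIcc Set.right_mem_uIcc
  rw [Real.norm_eq_abs, sub_zero, Real.norm_eq_abs] at hmv
  rw [abs_of_nonneg (by positivity : 0 ≤ |f 0| + A * Real.exp (c * |x|) * |x|)]
  have := abs_add_le (f 0) (f x - f 0)
  rw [add_sub_cancel] at this
  linarith

end ExpGrowth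

/-! ### Gaussian expectations as differentiable functions of mean and variance. -/

/-- The Lebesgue density of `N(m, C)`, as a function of the parameters `(m, C)`. -/
noncomputable def gaussDensity (a : ℝ × ℝ) (x : ℝ) : ℝ :=
  (Real.sqrt (2 * Real.pi * a.2))⁻¹ * Real.exp (-(x - a.1) ^ 2 / (2 * a.2))

theorem gaussianPDFReal_eq_gaussDensity {a : ℝ × ℝ} (ha : 0 < a.2) (x : ℝ) :
    gaussianPDFReal a.1 a.2.toNNReal x = gaussDensity a x := by
  rw [gaussianPDFReal_def, gaussDensity, Real.coe_toNNReal _ ha.le]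

theorem gaussDensity_pos {a : ℝ × ℝ} (ha : 0 < a.2) (x : ℝ) : 0 < gaussDensity a x := by
  have := Real.pi_pos
  unfold gaussDensity
  positivity

theorem measurable_gaussDensity (a : ℝ × ℝ) : Measurable (gaussDensity a) := by
  unfold gaussDensity
  fun_prop

theorem integral_gaussianOf {a : ℝ × ℝ} (ha : 0 < a.2) (g : ℝ → ℝ) :
    ∫ x, g x ∂(gaussianOf a) = ∫ x, gaussDensity a x * g x := by
  rw [gaussianOf, integral_gaussianReal_eq_integral_smul (by simpa using ha)]
  simp only [gaussianPDFReal_eq_gaussDensity ha, smul_eq_mul]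

theorem integrable_gaussianOf_iff {a : ℝ × ℝ} (ha : 0 < a.2) {g : ℝ → ℝ} :
    Integrable g (gaussianOf a) ↔ Integrable fun x => gaussDensity a x * g x := by
  rw [gaussianOf, gaussianReal_of_var_ne_zero _ (by simpa using ha),
    integrable_withDensity_iff_integrable_smul' (measurable_gaussianPDF _ _)
      (ae_of_all _ fun x => gaussianPDF_lt_top)]
  simp only [toReal_gaussianPDF, gaussianPDFReal_eq_gaussDensity ha, smul_eq_mul]

instance (a : ℝ × ℝ) : IsProbabilityMeasure (gaussianOf a) := by
  unfold gaussianOf; infer_instance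

theorem ExpGrowth.integrable_gaussianOf {g : ℝ → ℝ} (hg : ExpGrowth g) (a : ℝ × ℝ) :
    Integrable g (gaussianOf a) := hg.integrable _ _

theorem ExpGrowth.integrable_density {g : ℝ → ℝ} (hg : ExpGrowth g) {a : ℝ × ℝ} (ha : 0 < a.2) :
    Integrable fun x => gaussDensity a x * g x :=
  (integrable_gaussianOf_iff ha).1 (hg.integrable_gaussianOf a)

/-- The derivative of `log N(m, C)(x)` with respect to `(m, C)`. -/
noncomputable def gaussScore (a : ℝ × ℝ) (x : ℝ) : ℝ × ℝ →L[ℝ] ℝ :=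
  ((x - a.1) / a.2) • ContinuousLinearMap.fst ℝ ℝ ℝ +
    (((x - a.1) ^ 2 / a.2 ^ 2 - 1 / a.2) / 2) • ContinuousLinearMap.snd ℝ ℝ ℝ

theorem hasFDerivAt_gaussDensity {a : ℝ × ℝ} (ha : 0 < a.2) (x : ℝ) :
    HasFDerivAt (fun b => gaussDensity b x) (gaussDensity a x • gaussScore a x) a := by
  have hpi := Real.pi_pos
  have h2 : HasFDerivAt (fun b : ℝ × ℝ => b.2) (ContinuousLinearMap.snd ℝ ℝ ℝ) a :=
    hasFDerivAt_snd
  have h1 : HasFDerivAt (fun b : ℝ × ℝ => b.1) (ContinuousLinearMap.fst ℝ ℝ ℝ) a :=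
    hasFDerivAt_fst
  have hpos : 0 < 2 * Real.pi * a.2 := by positivity
  have hs : 0 < Real.sqrt (2 * Real.pi * a.2) := Real.sqrt_pos.2 hpos
  have hsq : Real.sqrt (2 * Real.pi * a.2) ^ 2 = 2 * Real.pi * a.2 := Real.sq_sqrt hpos.le
  have hA := (hasDerivAt_inv hs.ne').comp_hasFDerivAt a
    ((h2.const_mul (2 * Real.pi)).sqrt hpos.ne')
  have hB : HasFDerivAt (fun b : ℝ × ℝ => -(x - b.1) ^ 2 * (2 * b.2)⁻¹) _ a :=
    (((h1.const_sub x).pow 2).neg).mul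
      ((hasDerivAt_inv (by positivity : (2 : ℝ) * a.2 ≠ 0)).comp_hasFDerivAt a
        (h2.const_mul (2 : ℝ)))
  have hC := hA.mul hB.exp
  have heq : (fun b => gaussDensity b x) = fun b : ℝ × ℝ =>
      (Real.sqrt (2 * Real.pi * b.2))⁻¹ * Real.exp (-(x - b.1) ^ 2 * (2 * b.2)⁻¹) := by
    funext b; rw [gaussDensity, div_eq_mul_inv]
  rw [heq]
  refine hC.congr_fderiv ?_
  ext
  · simp [gaussScore, gaussDensity, div_eq_mul_inv]
    field_simp
  · simp [gaussScore, gaussDensity, div_eq_mul_inv]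
    rw [hsq]
    generalize (Real.sqrt (2 * Real.pi * a.2))⁻¹ = u
    generalize Real.exp _ = w
    field_simp
    ring

/-- Local domination of the Gaussian densities by a single wider Gaussian. -/
theorem gaussDensity_le {a₀ a : ℝ × ℝ} (h0 : 0 < a₀.2) (h1 : |a.1 - a₀.1| ≤ 1)
    (hl : a₀.2 / 2 ≤ a.2) (hu : a.2 ≤ 2 * a₀.2) (x : ℝ) :
    gaussDensity a x ≤ Real.sqrt 8 * Real.exp (1 / (4 * a₀.2)) *
      gaussDensity (a₀.1, 4 * a₀.2) x := by
  have hpi := Real.pi_pos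
  have ha : 0 < a.2 := by linarith
  -- The variances satisfy `4 * a₀.2 ≤ 8 * a.2`, whence the factor `√8`.
  have hs : (Real.sqrt (2 * Real.pi * a.2))⁻¹ ≤
      Real.sqrt 8 * (Real.sqrt (2 * Real.pi * (4 * a₀.2)))⁻¹ := by
    have : Real.sqrt (2 * Real.pi * (4 * a₀.2)) ≤
        Real.sqrt 8 * Real.sqrt (2 * Real.pi * a.2) := by
      rw [← Real.sqrt_mul (by norm_num)]
      apply Real.sqrt_le_sqrt
      nlinarith
    have hp : 0 < Real.sqrt (2 * Real.pi * (4 * a₀.2)) := Real.sqrt_pos.2 (by positivity)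
    have hq : 0 < Real.sqrt (2 * Real.pi * a.2) := Real.sqrt_pos.2 (by positivity)
    rw [← div_eq_mul_inv, le_div_iff₀ hp, inv_mul_le_iff₀ hq]
    linarith
  have he : Real.exp (-(x - a.1) ^ 2 / (2 * a.2)) ≤
      Real.exp (1 / (4 * a₀.2)) * Real.exp (-(x - a₀.1) ^ 2 / (2 * (4 * a₀.2))) := by
    rw [← Real.exp_add]
    apply Real.exp_le_exp.2
    have hd : (a.1 - a₀.1) ^ 2 ≤ 1 := by
      rw [← sq_abs]; exact pow_le_one₀ (abs_nonneg _) h1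
    have h2 : (x - a₀.1) ^ 2 ≤ 2 * (x - a.1) ^ 2 + 2 := by
      nlinarith [sq_nonneg ((x - a.1) - (a.1 - a₀.1))]
    -- The upper bound on `a.2` doubles the denominator, and shifting the centre by at most `1`
    -- costs another factor `2` and the constant `2 / (8 * a₀.2)`.
    calc -(x - a.1) ^ 2 / (2 * a.2) ≤ -(x - a.1) ^ 2 / (4 * a₀.2) := by
          rw [neg_div, neg_div, neg_le_neg_iff]
          exact div_le_div_of_nonneg_left (sq_nonneg _) (by positivity) (by linarith)
      _ ≤ (2 - (x - a₀.1) ^ 2) / (2 * (4 * a₀.2)) := by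
          rw [div_le_div_iff₀ (by positivity) (by positivity)]
          nlinarith
      _ = _ := by field_simp; ring
  calc gaussDensity a x ≤ (Real.sqrt 8 * (Real.sqrt (2 * Real.pi * (4 * a₀.2)))⁻¹) *
        (Real.exp (1 / (4 * a₀.2)) * Real.exp (-(x - a₀.1) ^ 2 / (2 * (4 * a₀.2)))) :=
        mul_le_mul hs he (Real.exp_pos _).le (by positivity)
    _ = _ := by unfold gaussDensity; ring

/-- The score is polynomial in `x`, so its local supremum over the parameters still has exponential
growth and can enter the dominating function. -/
theorem norm_gaussScore_le {a₀ a : ℝ × ℝ} (h0 : 0 < a₀.2) (h1 : |a.1 - a₀.1| ≤ 1)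
    (hl : a₀.2 / 2 ≤ a.2) (x : ℝ) :
    ‖gaussScore a x‖ ≤ (|x - a₀.1| + 1) * (2 / a₀.2) +
      ((|x - a₀.1| + 1) ^ 2 * (2 / a₀.2) ^ 2 + 2 / a₀.2) / 2 := by
  have ha : 0 < a.2 := by linarith
  have hx : |x - a.1| ≤ |x - a₀.1| + 1 := by
    have := abs_sub_le x a₀.1 a.1
    rw [abs_sub_comm a₀.1] at this
    linarith
  have hi : 1 / a.2 ≤ 2 / a₀.2 := by
    rw [div_le_div_iff₀ ha h0]; linarith
  have hi0 : 0 < 1 / a.2 := by positivity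
  have hm : |x - a.1| * (1 / a.2) ≤ (|x - a₀.1| + 1) * (2 / a₀.2) :=
    mul_le_mul hx hi hi0.le (by positivity)
  refine (norm_add_le _ _).trans (add_le_add ?_ ?_)
  · rw [norm_smul, Real.norm_eq_abs, abs_div, abs_of_pos ha, div_eq_mul_one_div]
    refine (mul_le_of_le_one_right (by positivity) (ContinuousLinearMap.norm_fst_le ℝ ℝ ℝ)).trans hm
  · rw [norm_smul, Real.norm_eq_abs]
    refine (mul_le_of_le_one_right (by positivity)
      (ContinuousLinearMap.norm_snd_le ℝ ℝ ℝ)).trans ?_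
    rw [abs_div, abs_of_pos (two_pos : (0 : ℝ) < 2)]
    refine div_le_div_of_nonneg_right ((abs_sub _ _).trans (add_le_add ?_ ?_)) two_pos.le
    · rw [← div_pow, abs_pow, abs_div, abs_of_pos ha, ← mul_pow, div_eq_mul_one_div]
      exact pow_le_pow_left₀ (by positivity) hm 2
    · rwa [abs_of_pos hi0]

/-- Differentiation of Gaussian expectations with respect to mean and variance. -/
theorem hasFDerivAt_integral_gaussianOf {g : ℝ → ℝ} (hg : ExpGrowth g) {a : ℝ × ℝ}
    (ha : 0 < a.2) :
    HasFDerivAt (fun b => ∫ x, g x ∂(gaussianOf b))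
      ((∫ x, g x * ((x - a.1) / a.2) ∂(gaussianOf a)) • ContinuousLinearMap.fst ℝ ℝ ℝ +
        (∫ x, g x * (((x - a.1) ^ 2 / a.2 ^ 2 - 1 / a.2) / 2) ∂(gaussianOf a)) •
          ContinuousLinearMap.snd ℝ ℝ ℝ) a := by
  have hm1 : ExpGrowth fun x => g x * ((x - a.1) / a.2) :=
    hg.mul ((ExpGrowth.sub_const _).div_const _)
  have hm2 : ExpGrowth fun x => g x * (((x - a.1) ^ 2 / a.2 ^ 2 - 1 / a.2) / 2) :=
    hg.mul (((((ExpGrowth.sub_const _).pow 2).div_const _).sub (ExpGrowth.const _)).div_const _)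
  set s : Set (ℝ × ℝ) := {b | |b.1 - a.1| ≤ 1 ∧ a.2 / 2 ≤ b.2 ∧ b.2 ≤ 2 * a.2} with hs
  have hsn : s ∈ nhds a := by
    have e1 : ∀ᶠ b : ℝ × ℝ in nhds a, |b.1 - a.1| < 1 :=
      (show Continuous fun b : ℝ × ℝ => |b.1 - a.1| by fun_prop).continuousAt.eventually_lt
        continuousAt_const (by simp)
    have e2 : ∀ᶠ b : ℝ × ℝ in nhds a, a.2 / 2 < b.2 :=
      continuousAt_const.eventually_lt continuous_snd.continuousAt (by linarith)
    have e3 : ∀ᶠ b : ℝ × ℝ in nhds a, b.2 < 2 * a.2 :=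
      continuous_snd.continuousAt.eventually_lt continuousAt_const (by linarith)
    filter_upwards [e1, e2, e3] with b h1 h2 h3 using ⟨h1.le, h2.le, h3.le⟩
  set P : ℝ → ℝ := fun x => (|x - a.1| + 1) * (2 / a.2) +
      ((|x - a.1| + 1) ^ 2 * (2 / a.2) ^ 2 + 2 / a.2) / 2 with hP
  have hPg : ExpGrowth P := by
    have h1 : ExpGrowth fun x => |x - a.1| + 1 := (ExpGrowth.sub_const _).abs.add (.const _)
    exact (h1.mul (.const _)).add ((((h1.pow 2).mul (.const _)).add (.const _)).div_const _)
  -- The derivative falls on the density, so `g` need not even be continuous. This allows `g = (log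
  -- ρ)''` and, later, the indicator of an interval.
  have hmain := hasFDerivAt_integral_of_dominated_of_fderiv_le (μ := volume) (𝕜 := ℝ)
    (F := fun b x => gaussDensity b x * g x)
    (F' := fun b x => g x • (gaussDensity b x • gaussScore b x)) (x₀ := a) (s := s)
    (bound := fun x => gaussDensity (a.1, 4 * a.2) x *
      (Real.sqrt 8 * Real.exp (1 / (4 * a.2)) * (|g x| * P x))) hsn
    (Eventually.of_forall fun b =>
      ((measurable_gaussDensity b).mul hg.measurable).aestronglyMeasurable)
    (hg.integrable_density ha) ?_ ?_ ?_ ?_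
  · have heq : (fun b => ∫ x, g x ∂(gaussianOf b)) =ᶠ[nhds a]
        fun b => ∫ x, gaussDensity b x * g x := by
      filter_upwards [hsn] with b hb
      exact integral_gaussianOf (by linarith [hb.2.1]) g
    refine (hmain.congr_of_eventuallyEq heq).congr_fderiv ?_
    rw [integral_gaussianOf ha, integral_gaussianOf ha]
    refine Eq.trans ?_ (congrArg₂ (· + ·)
      (integral_smul_const (𝕜 := ℝ) _ (ContinuousLinearMap.fst ℝ ℝ ℝ))
      (integral_smul_const (𝕜 := ℝ) _ (ContinuousLinearMap.snd ℝ ℝ ℝ)))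
    refine Eq.trans ?_ (integral_add ((hm1.integrable_density ha).smul_const
      (ContinuousLinearMap.fst ℝ ℝ ℝ)) ((hm2.integrable_density ha).smul_const
      (ContinuousLinearMap.snd ℝ ℝ ℝ)))
    congr 1
    funext x
    simp only [gaussScore, smul_add, smul_smul]
    congr 2 <;> ring
  · have h1 := (hm1.integrable_density ha).smul_const (ContinuousLinearMap.fst ℝ ℝ ℝ)
    have h2 := (hm2.integrable_density ha).smul_const (ContinuousLinearMap.snd ℝ ℝ ℝ)
    refine (h1.add h2).aestronglyMeasurable.congr (ae_of_all _ fun x => ?_)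
    simp only [gaussScore, smul_add, smul_smul, Pi.add_apply]
    congr 2 <;> ring
  · refine ae_of_all _ fun x b hb => ?_
    have hb2 : 0 < b.2 := by linarith [hb.2.1]
    have hd := gaussDensity_le ha hb.1 hb.2.1 hb.2.2 x
    have hsc := norm_gaussScore_le ha hb.1 hb.2.1 x
    rw [norm_smul, norm_smul, Real.norm_eq_abs, Real.norm_eq_abs,
      abs_of_pos (gaussDensity_pos hb2 x)]
    have := mul_le_mul hd hsc (norm_nonneg _) ((gaussDensity_pos hb2 x).le.trans hd)
    calc |g x| * (gaussDensity b x * ‖gaussScore b x‖) ≤ |g x| * _ :=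
          mul_le_mul_of_nonneg_left this (abs_nonneg _)
      _ = _ := by simp only [hP]; ring
  · exact ((hg.abs.mul hPg).const_mul _).integrable_density (a := (a.1, 4 * a.2)) (by simpa using ha)
  · refine ae_of_all _ fun x b hb => ?_
    exact (hasFDerivAt_gaussDensity (by linarith [hb.2.1]) x).mul_const (g x)

/-! ### Stein identities and Gaussian moments. -/

theorem hasDerivAt_gaussDensity {a : ℝ × ℝ} (ha : 0 < a.2) (x : ℝ) :
    HasDerivAt (gaussDensity a) (-(gaussDensity a x * ((x - a.1) / a.2))) x := by
  have h := ((((hasDerivAt_id x).sub_const a.1).pow 2).neg.div_const (2 * a.2)).exp.const_mul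
    (Real.sqrt (2 * Real.pi * a.2))⁻¹
  refine h.congr_deriv ?_
  simp [gaussDensity]
  field_simp

/-- Stein's identity. -/
theorem stein_identity {g g' : ℝ → ℝ} (h : ∀ x, HasDerivAt g (g' x) x) (hg : ExpGrowth g)
    (hg' : ExpGrowth g') {a : ℝ × ℝ} (ha : 0 < a.2) :
    ∫ x, g x * ((x - a.1) / a.2) ∂(gaussianOf a) = ∫ x, g' x ∂(gaussianOf a) := by
  have h1 : ExpGrowth fun x => g x * ((x - a.1) / a.2) :=
    hg.mul ((ExpGrowth.sub_const _).div_const _)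
  have hi := integral_mul_deriv_eq_deriv_mul_of_integrable (fun x _ => h x)
    (fun x _ => hasDerivAt_gaussDensity ha x)
    ((h1.neg.integrable_density ha).congr (ae_of_all _ fun x => by simp; ring))
    ((hg'.integrable_density ha).congr (ae_of_all _ fun x => by simp; ring))
    ((hg.integrable_density ha).congr (ae_of_all _ fun x => by simp; ring))
  rw [integral_gaussianOf ha, integral_gaussianOf ha, ← neg_inj, ← integral_neg]
  calc _ = ∫ x, g x * -(gaussDensity a x * ((x - a.1) / a.2)) := by
        congr 1; funext x; ring
    _ = _ := by rw [hi]; congr 2; funext x; ring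

theorem integral_sub_mean {a : ℝ × ℝ} (ha : 0 < a.2) : ∫ x, (x - a.1) ∂(gaussianOf a) = 0 := by
  have h := stein_identity (g := fun _ => (1 : ℝ)) (g' := fun _ => 0)
    (fun x => hasDerivAt_const x 1) (.const 1) (.const 0) ha
  simp only [one_mul, integral_zero, integral_div] at h
  exact (div_eq_zero_iff.1 h).resolve_right ha.ne'

theorem integral_sub_mean_sq {a : ℝ × ℝ} (ha : 0 < a.2) :
    ∫ x, (x - a.1) ^ 2 ∂(gaussianOf a) = a.2 := by
  have h := stein_identity (g := fun x => x - a.1) (g' := fun _ => 1)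
    (fun x => (hasDerivAt_id x).sub_const _) (.sub_const _) (.const 1) ha
  have e : (fun x => (x - a.1) * ((x - a.1) / a.2)) = fun x => (x - a.1) ^ 2 / a.2 := by
    funext x; ring
  rw [e, integral_div] at h
  simpa [div_eq_iff ha.ne'] using h

/-- The second moment of an affine function of a Gaussian variable. -/
theorem integral_affine_sq {a : ℝ × ℝ} (ha : 0 < a.2) (p q : ℝ) :
    ∫ x, (p + q * (x - a.1)) ^ 2 ∂(gaussianOf a) = p ^ 2 + q ^ 2 * a.2 := by
  have e : (fun x => (p + q * (x - a.1)) ^ 2) =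
      fun x => (p ^ 2 + 2 * p * q * (x - a.1)) + q ^ 2 * (x - a.1) ^ 2 := by
    funext x; ring
  have h1 : ExpGrowth fun x => 2 * p * q * (x - a.1) := (ExpGrowth.sub_const _).const_mul _
  have h2 : ExpGrowth fun x => q ^ 2 * (x - a.1) ^ 2 := ((ExpGrowth.sub_const _).pow 2).const_mul _
  rw [e, integral_add (((ExpGrowth.const _).add h1).integrable_gaussianOf a)
    (h2.integrable_gaussianOf a), integral_add ((ExpGrowth.const _).integrable_gaussianOf a)
    (h1.integrable_gaussianOf a), integral_const_mul, integral_const_mul, integral_sub_mean ha,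
    integral_sub_mean_sq ha]
  simp

/-- The second-order Stein identity, for once differentiable functions. -/
theorem stein_identity_sq {g g' : ℝ → ℝ} (h : ∀ x, HasDerivAt g (g' x) x) (hg : ExpGrowth g)
    (hg' : ExpGrowth g') {a : ℝ × ℝ} (ha : 0 < a.2) :
    ∫ x, g x * (((x - a.1) ^ 2 / a.2 ^ 2 - 1 / a.2) / 2) ∂(gaussianOf a) =
      (∫ x, g' x * ((x - a.1) / a.2) ∂(gaussianOf a)) / 2 := by
  have hs : ExpGrowth fun x => (x - a.1) / a.2 := (ExpGrowth.sub_const _).div_const _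
  -- Differentiating the factor `(x - m)/C` yields exactly the term `g / C` that the Hermite weight
  -- subtracts; only one derivative of `g` is used.
  have h1 := stein_identity (g := fun x => g x * ((x - a.1) / a.2))
    (g' := fun x => g' x * ((x - a.1) / a.2) + g x * (1 / a.2))
    (fun x => (h x).mul (((hasDerivAt_id x).sub_const _).div_const _)) (hg.mul hs)
    ((hg'.mul hs).add (hg.mul (.const _))) ha
  have i1 := (hg'.mul hs).integrable_gaussianOf a
  have i2 := (hg.mul (.const (1 / a.2))).integrable_gaussianOf a
  have i3 := ((hg.mul hs).mul hs).integrable_gaussianOf a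
  rw [integral_add i1 i2] at h1
  have e : (fun x => g x * (((x - a.1) ^ 2 / a.2 ^ 2 - 1 / a.2) / 2)) = fun x =>
      (g x * ((x - a.1) / a.2) * ((x - a.1) / a.2) - g x * (1 / a.2)) / 2 := by
    funext x; ring
  rw [e, integral_div, integral_sub i3 i2, h1, add_sub_cancel_right]

/-! ### Affine transport between Gaussians and quadratic upper bounds. -/

theorem gaussianOf_eq_map {a b : ℝ × ℝ} (ha : 0 < a.2) (hb : 0 < b.2) :
    gaussianOf b = (gaussianOf a).map fun x => (b.1 - Real.sqrt (b.2 / a.2) * a.1) +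
      Real.sqrt (b.2 / a.2) * x := by
  have e : (fun x => (b.1 - Real.sqrt (b.2 / a.2) * a.1) + Real.sqrt (b.2 / a.2) * x) =
      (fun x => (b.1 - Real.sqrt (b.2 / a.2) * a.1) + x) ∘
        fun x => Real.sqrt (b.2 / a.2) * x := rfl
  rw [e, ← Measure.map_map (by fun_prop) (by fun_prop), gaussianOf, gaussianOf,
    gaussianReal_map_const_mul, gaussianReal_map_const_add]
  congr 1
  · ring
  · ext
    have : (0 : ℝ) ≤ b.2 / a.2 := by positivity
    simp only [NNReal.coe_mul, Real.coe_toNNReal _ ha.le, Real.coe_toNNReal _ hb.le, NNReal.coe_mk,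
      Real.sq_sqrt this]
    field_simp

theorem integral_gaussianOf_eq_affine {a b : ℝ × ℝ} (ha : 0 < a.2) (hb : 0 < b.2) {g : ℝ → ℝ}
    (hg : Measurable g) :
    ∫ x, g x ∂(gaussianOf b) =
      ∫ x, g (b.1 + Real.sqrt (b.2 / a.2) * (x - a.1)) ∂(gaussianOf a) := by
  rw [gaussianOf_eq_map ha hb, integral_map (by fun_prop) hg.aestronglyMeasurable]
  congr 1; funext x; congr 1; ring

/-- The upper quadratic bound for a strongly concave function. -/
theorem le_of_deriv2_le {f f1 f2 : ℝ → ℝ} {α : ℝ} (h1 : ∀ x, HasDerivAt f (f1 x) x)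
    (h2 : ∀ x, HasDerivAt f1 (f2 x) x) (h : ∀ x, f2 x ≤ -α) (x y : ℝ) :
    f y ≤ f x + f1 x * (y - x) - α / 2 * (y - x) ^ 2 := by
  have hφ : ∀ z, HasDerivAt (fun z => f x + f1 x * (z - x) - α / 2 * (z - x) ^ 2 - f z)
      (f1 x - α * (z - x) - f1 z) z := fun z => by
    refine (((((hasDerivAt_id z).sub_const x).const_mul (f1 x)).const_add (f x)).sub
      ((((hasDerivAt_id z).sub_const x).pow 2).const_mul (α / 2)) |>.sub (h1 z)).congr_deriv ?_
    simp; ring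
  have hφ' : ∀ z, HasDerivAt (fun z => f1 x - α * (z - x) - f1 z) (-α - f2 z) z := fun z => by
    refine (((((hasDerivAt_id z).sub_const x).const_mul α).const_sub (f1 x)).sub
      (h2 z)).congr_deriv ?_
    simp
  have hmono : Monotone (fun z => f1 x - α * (z - x) - f1 z) :=
    monotone_of_deriv_nonneg (fun z => (hφ' z).differentiableAt) fun z => by
      rw [(hφ' z).deriv]; linarith [h z]
  have hd : Differentiable ℝ (fun z => f x + f1 x * (z - x) - α / 2 * (z - x) ^ 2 - f z) :=
    fun z => (hφ z).differentiableAt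
  rcases le_total x y with hxy | hxy
  · have := monotoneOn_of_deriv_nonneg (convex_Ici x) hd.continuous.continuousOn
      hd.differentiableOn (fun z hz => by
        rw [(hφ z).deriv]
        rw [interior_Ici] at hz
        simpa using hmono hz.le) Set.self_mem_Ici hxy hxy
    simp only [sub_self] at this
    linarith
  · have := antitoneOn_of_deriv_nonpos (convex_Iic x) hd.continuous.continuousOn
      hd.differentiableOn (fun z hz => by
        rw [(hφ z).deriv]
        rw [interior_Iic] at hz
        simpa using hmono hz.le) hxy Set.self_mem_Iic hxy
    simp only [sub_self] at this
    linarith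

/-! ### Regularity and growth of the log-density of a target. -/

namespace IsLogConcaveTarget

variable {ρ : ℝ → ℝ} {α β : ℝ}

theorem hasDerivAt_log (h : IsLogConcaveTarget ρ α β) (x : ℝ) :
    HasDerivAt (fun θ => Real.log (ρ θ)) (deriv (fun θ => Real.log (ρ θ)) x) x :=
  (h.contDiff_log.differentiable (by norm_num) x).hasDerivAt

theorem contDiff_deriv_log (h : IsLogConcaveTarget ρ α β) :
    ContDiff ℝ 1 (deriv fun θ => Real.log (ρ θ)) :=
  h.contDiff_log.deriv'

theorem hasDerivAt_deriv_log (h : IsLogConcaveTarget ρ α β) (x : ℝ) :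
    HasDerivAt (deriv fun θ => Real.log (ρ θ)) (deriv (deriv fun θ => Real.log (ρ θ)) x) x :=
  (h.contDiff_deriv_log.differentiable (by norm_num) x).hasDerivAt

theorem expGrowth_deriv2_log (h : IsLogConcaveTarget ρ α β) :
    ExpGrowth (deriv (deriv fun θ => Real.log (ρ θ))) :=
  (ExpGrowth.const β).mono (measurable_deriv _) fun x => by
    have h1 := h.strongly_logconcave x
    have h2 := h.smooth x
    have h3 := h.alpha_pos
    rw [abs_of_nonpos (by linarith), abs_of_nonneg (by linarith)]
    exact h2

theorem expGrowth_deriv_log (h : IsLogConcaveTarget ρ α β) :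
    ExpGrowth (deriv fun θ => Real.log (ρ θ)) :=
  .of_hasDerivAt h.hasDerivAt_deriv_log h.expGrowth_deriv2_log

theorem expGrowth_log (h : IsLogConcaveTarget ρ α β) :
    ExpGrowth fun θ => Real.log (ρ θ) :=
  .of_hasDerivAt h.hasDerivAt_log h.expGrowth_deriv_log

theorem log_le (h : IsLogConcaveTarget ρ α β) (x y : ℝ) :
    Real.log (ρ y) ≤ Real.log (ρ x) + deriv (fun θ => Real.log (ρ θ)) x * (y - x) -
      α / 2 * (y - x) ^ 2 :=
  le_of_deriv2_le (f := fun θ => Real.log (ρ θ)) h.hasDerivAt_log h.hasDerivAt_deriv_log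
    (fun z => by linarith [h.strongly_logconcave z]) x y

theorem measurable (h : IsLogConcaveTarget ρ α β) : Measurable ρ := by
  have : ρ = fun x => Real.exp (Real.log (ρ x)) := by
    funext x; rw [Real.exp_log (h.pos x)]
  rw [this]
  exact h.expGrowth_log.measurable.exp

theorem isProbabilityMeasure (h : IsLogConcaveTarget ρ α β) :
    IsProbabilityMeasure (targetMeasure ρ) := by
  have hi : Integrable ρ := by
    by_contra hn
    have := h.integral_eq_one
    rw [integral_undef hn] at this
    norm_num at this
  refine ⟨?_⟩
  rw [targetMeasure, withDensity_apply _ MeasurableSet.univ, Measure.restrict_univ,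
    ← ofReal_integral_eq_lintegral_ofReal hi (ae_of_all _ fun x => (h.pos x).le),
    h.integral_eq_one, ENNReal.ofReal_one]

end IsLogConcaveTarget

/-! ### The free energy: stationarity, convexity and the unique minimizer. -/

/-- The Kullback-Leibler divergence `KL[N(m, C) ‖ ρ]`, up to an additive constant. -/
noncomputable def gaussianFreeEnergy (ρ : ℝ → ℝ) (a : ℝ × ℝ) : ℝ :=
  -(Real.log a.2 / 2) - ∫ θ, Real.log (ρ θ) ∂(gaussianOf a)

theorem log_gaussDensity {a : ℝ × ℝ} (ha : 0 < a.2) (x : ℝ) :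
    Real.log (gaussDensity a x) = -(Real.log (2 * Real.pi) / 2) - Real.log a.2 / 2 -
      (x - a.1) ^ 2 / (2 * a.2) := by
  have hpi := Real.pi_pos
  have hs : 0 < Real.sqrt (2 * Real.pi * a.2) := Real.sqrt_pos.2 (by positivity)
  rw [gaussDensity, Real.log_mul (inv_pos.2 hs).ne' (Real.exp_pos _).ne', Real.log_exp,
    Real.log_inv, Real.log_sqrt (by positivity), Real.log_mul (by positivity) ha.ne']
  ring

namespace IsLogConcaveTarget

variable {ρ : ℝ → ℝ} {α β : ℝ}

theorem llr_gaussianOf (h : IsLogConcaveTarget ρ α β) {a : ℝ × ℝ} (ha : 0 < a.2) :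
    llr (gaussianOf a) (targetMeasure ρ) =ᵐ[gaussianOf a]
      fun x => Real.log (gaussDensity a x) - Real.log (ρ x) := by
  have hv : a.2.toNNReal ≠ 0 := by simpa using ha
  refine (gaussianReal_absolutelyContinuous a.1 hv).ae_le ?_
  have h1 := Measure.rnDeriv_withDensity_right (gaussianOf a) volume
    (f := fun θ => ENNReal.ofReal (ρ θ)) h.measurable.ennreal_ofReal.aemeasurable
    (ae_of_all _ fun x => by simpa using h.pos x) (ae_of_all _ fun x => ENNReal.ofReal_ne_top)
  have h2 := rnDeriv_gaussianReal a.1 a.2.toNNReal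
  filter_upwards [h1, h2] with x h1 h2
  rw [llr, targetMeasure, h1, gaussianOf, h2, ENNReal.toReal_mul, ENNReal.toReal_inv,
    ENNReal.toReal_ofReal (h.pos x).le, toReal_gaussianPDF, gaussianPDFReal_eq_gaussDensity ha,
    Real.log_mul (inv_pos.2 (h.pos x)).ne' (gaussDensity_pos ha x).ne', Real.log_inv]
  ring

/-- The Gaussian entropy is explicit, which leaves only the free energy and constants. Finiteness is
recorded so that comparisons in `ENNReal` become comparisons of reals. -/
theorem klDiv_gaussianOf (h : IsLogConcaveTarget ρ α β) {a : ℝ × ℝ} (ha : 0 < a.2) :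
    InformationTheory.klDiv (gaussianOf a) (targetMeasure ρ) ≠ ⊤ ∧
    (InformationTheory.klDiv (gaussianOf a) (targetMeasure ρ)).toReal =
      gaussianFreeEnergy ρ a - Real.log (2 * Real.pi) / 2 - 1 / 2 := by
  have hv : a.2.toNNReal ≠ 0 := by simpa using ha
  have := h.isProbabilityMeasure
  have hac : gaussianOf a ≪ targetMeasure ρ :=
    (gaussianReal_absolutelyContinuous a.1 hv).trans
      (withDensity_absolutelyContinuous' h.measurable.ennreal_ofReal.aemeasurable
        (ae_of_all _ fun x => by simpa using h.pos x))
  have hq : ExpGrowth fun x => (x - a.1) ^ 2 / (2 * a.2) :=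
    ((ExpGrowth.sub_const _).pow 2).div_const _
  have hc : ExpGrowth fun _ : ℝ => -(Real.log (2 * Real.pi) / 2) - Real.log a.2 / 2 := .const _
  have e : (fun x => Real.log (gaussDensity a x) - Real.log (ρ x)) = fun x =>
      -(Real.log (2 * Real.pi) / 2) - Real.log a.2 / 2 - (x - a.1) ^ 2 / (2 * a.2) -
        Real.log (ρ x) := by
    funext x; rw [log_gaussDensity ha]
  have hl := h.llr_gaussianOf ha
  rw [e] at hl
  refine ⟨InformationTheory.klDiv_ne_top hac
    ((((hc.sub hq).sub h.expGrowth_log).integrable_gaussianOf a).congr hl.symm), ?_⟩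
  rw [InformationTheory.toReal_klDiv_of_measure_eq hac (by simp), integral_congr_ae hl,
    integral_sub ((hc.sub hq).integrable_gaussianOf a) (h.expGrowth_log.integrable_gaussianOf a),
    integral_sub (hc.integrable_gaussianOf a) (hq.integrable_gaussianOf a), integral_div,
    integral_sub_mean_sq ha, gaussianFreeEnergy]
  simp only [integral_const, probReal_univ, smul_eq_mul, one_mul]
  field_simp
  ring

theorem isGaussianVIMinimizer_iff (h : IsLogConcaveTarget ρ α β) (a : ℝ × ℝ) :
    IsGaussianVIMinimizer ρ a ↔
      0 < a.2 ∧ ∀ b : ℝ × ℝ, 0 < b.2 → gaussianFreeEnergy ρ a ≤ gaussianFreeEnergy ρ b := by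
  refine and_congr_right fun ha => forall₂_congr fun b hb => ?_
  obtain ⟨h1, h2⟩ := h.klDiv_gaussianOf ha
  obtain ⟨h3, h4⟩ := h.klDiv_gaussianOf hb
  rw [Set.mem_ofPred_eq, ← ENNReal.toReal_le_toReal h1 h3, h2, h4]
  constructor <;> intro <;> linarith

theorem hasFDerivAt_gaussianFreeEnergy (h : IsLogConcaveTarget ρ α β) {a : ℝ × ℝ}
    (ha : 0 < a.2) :
    HasFDerivAt (gaussianFreeEnergy ρ)
      (-((1 / (2 * a.2)) • ContinuousLinearMap.snd ℝ ℝ ℝ) -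
        ((∫ θ, deriv (fun x => Real.log (ρ x)) θ ∂(gaussianOf a)) •
            ContinuousLinearMap.fst ℝ ℝ ℝ +
          ((∫ θ, deriv (deriv (fun x => Real.log (ρ x))) θ ∂(gaussianOf a)) / 2) •
            ContinuousLinearMap.snd ℝ ℝ ℝ)) a := by
  have h1 := hasFDerivAt_integral_gaussianOf h.expGrowth_log ha
  rw [stein_identity h.hasDerivAt_log h.expGrowth_log h.expGrowth_deriv_log ha,
    stein_identity_sq h.hasDerivAt_log h.expGrowth_log h.expGrowth_deriv_log ha,
    stein_identity h.hasDerivAt_deriv_log h.expGrowth_deriv_log h.expGrowth_deriv2_log ha] at h1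
  have h2 : HasFDerivAt (fun b : ℝ × ℝ => Real.log b.2 / 2)
      ((1 / (2 * a.2)) • ContinuousLinearMap.snd ℝ ℝ ℝ) a := by
    have := ((Real.hasDerivAt_log ha.ne').div_const 2).comp_hasFDerivAt a
      (hasFDerivAt_snd (𝕜 := ℝ) (E := ℝ) (F := ℝ) (p := a))
    refine this.congr_fderiv ?_
    congr 1
    field_simp
  exact h2.neg.sub h1

/-- The stationarity conditions of the free energy. -/
theorem stationary_of_isGaussianVIMinimizer (h : IsLogConcaveTarget ρ α β) {a : ℝ × ℝ}
    (hmin : IsGaussianVIMinimizer ρ a) :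
    ∫ θ, deriv (fun x => Real.log (ρ x)) θ ∂(gaussianOf a) = 0 ∧
      a.2 * ∫ θ, deriv (deriv (fun x => Real.log (ρ x))) θ ∂(gaussianOf a) = -1 := by
  obtain ⟨ha, hle⟩ := (h.isGaussianVIMinimizer_iff a).1 hmin
  have hloc : IsLocalMin (gaussianFreeEnergy ρ) a := by
    have : ∀ᶠ b : ℝ × ℝ in nhds a, 0 < b.2 :=
      continuousAt_const.eventually_lt continuous_snd.continuousAt ha
    filter_upwards [this] with b hb using hle b hb
  have h0 := hloc.hasFDerivAt_eq_zero (h.hasFDerivAt_gaussianFreeEnergy ha)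
  have e1 := congrArg (fun L : ℝ × ℝ →L[ℝ] ℝ => L (1, 0)) h0
  have e2 := congrArg (fun L : ℝ × ℝ →L[ℝ] ℝ => L (0, 1)) h0
  simp at e1 e2
  refine ⟨e1, ?_⟩
  field_simp at e2
  linarith

/-- Strong convexity of the free energy in mean and standard deviation, at a stationary point. -/
theorem gaussianFreeEnergy_ge (h : IsLogConcaveTarget ρ α β) {a b : ℝ × ℝ} (ha : 0 < a.2)
    (h1 : ∫ θ, deriv (fun x => Real.log (ρ x)) θ ∂(gaussianOf a) = 0)
    (h2 : a.2 * ∫ θ, deriv (deriv (fun x => Real.log (ρ x))) θ ∂(gaussianOf a) = -1)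
    (hb : 0 < b.2) :
    gaussianFreeEnergy ρ a +
        α / 2 * ((b.1 - a.1) ^ 2 + (Real.sqrt (b.2 / a.2) - 1) ^ 2 * a.2) ≤
      gaussianFreeEnergy ρ b := by
  set r := Real.sqrt (b.2 / a.2) with hr
  have hr0 : 0 < r := Real.sqrt_pos.2 (by positivity)
  -- The tangent line of `log` at `1`. Its contribution `r - 1` to the free energy cancels against
  -- the first-order term in the standard deviation.
  have hlog : Real.log b.2 ≤ Real.log a.2 + 2 * (r - 1) := by
    have h3 := Real.log_le_sub_one_of_pos hr0
    rw [hr, Real.log_sqrt (by positivity), Real.log_div hb.ne' ha.ne', ← hr] at h3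
    linarith
  have hst := stein_identity h.hasDerivAt_deriv_log h.expGrowth_deriv_log h.expGrowth_deriv2_log ha
  set f1 := deriv fun x => Real.log (ρ x) with hf1
  have g1 : ExpGrowth f1 := h.expGrowth_deriv_log
  have gs : ExpGrowth fun x => (x - a.1) / a.2 := (ExpGrowth.sub_const _).div_const _
  have k1 : ExpGrowth fun x => (b.1 - a.1) * f1 x := g1.const_mul _
  have k2 : ExpGrowth fun x => (r - 1) * a.2 * (f1 x * ((x - a.1) / a.2)) :=
    (g1.mul gs).const_mul _
  have k3 : ExpGrowth fun x => α / 2 * (b.1 - a.1 + (r - 1) * (x - a.1)) ^ 2 :=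
    ((((ExpGrowth.const _).add ((ExpGrowth.sub_const _).const_mul _)).pow 2).const_mul _)
  have hI : ∫ x, Real.log (ρ x) ∂(gaussianOf b) ≤ ∫ x, Real.log (ρ x) ∂(gaussianOf a) +
      (b.1 - a.1) * ∫ x, f1 x ∂(gaussianOf a) +
      (r - 1) * a.2 * ∫ x, f1 x * ((x - a.1) / a.2) ∂(gaussianOf a) -
      α / 2 * ((b.1 - a.1) ^ 2 + (r - 1) ^ 2 * a.2) := by
    -- The transport map moves `x` by `b.1 - a.1 + (r - 1) * (x - a.1)`; the quadratic bound for
    -- `log ρ` at `x` is integrated along this displacement.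
    rw [integral_gaussianOf_eq_affine ha hb h.expGrowth_log.measurable, ← integral_affine_sq ha,
      ← integral_const_mul, ← integral_const_mul, ← integral_const_mul,
      ← integral_add (h.expGrowth_log.integrable_gaussianOf a) (k1.integrable_gaussianOf a),
      ← integral_add ((h.expGrowth_log.add k1).integrable_gaussianOf a)
        (k2.integrable_gaussianOf a),
      ← integral_sub (((h.expGrowth_log.add k1).add k2).integrable_gaussianOf a)
        (k3.integrable_gaussianOf a)]
    refine integral_mono ?_ ((((h.expGrowth_log.add k1).add k2).sub k3).integrable_gaussianOf a)
      fun x => ?_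
    · have := (h.expGrowth_log.comp_affine (b.1 - r * a.1) r).integrable_gaussianOf a
      refine this.congr (ae_of_all _ fun x => ?_)
      simp only [hr]; ring_nf
    · have := h.log_le x (b.1 + r * (x - a.1))
      simp only
      have e : f1 x * (b.1 + r * (x - a.1) - x) = (b.1 - a.1) * f1 x +
          (r - 1) * a.2 * (f1 x * ((x - a.1) / a.2)) := by
        field_simp; ring
      rw [← hf1, e] at this
      calc _ ≤ _ := this
        _ = _ := by ring
  rw [h1, hst] at hI
  unfold gaussianFreeEnergy
  have : (r - 1) * a.2 * ∫ x, deriv f1 x ∂(gaussianOf a) = -(r - 1) := by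
    rw [mul_assoc, h2]; ring
  rw [this] at hI
  linarith

theorem isGaussianVIMinimizer_of_stationary (h : IsLogConcaveTarget ρ α β) {a : ℝ × ℝ}
    (ha : 0 < a.2) (h1 : ∫ θ, deriv (fun x => Real.log (ρ x)) θ ∂(gaussianOf a) = 0)
    (h2 : a.2 * ∫ θ, deriv (deriv (fun x => Real.log (ρ x))) θ ∂(gaussianOf a) = -1) :
    IsGaussianVIMinimizer ρ a := by
  refine (h.isGaussianVIMinimizer_iff a).2 ⟨ha, fun b hb => ?_⟩
  have := h.gaussianFreeEnergy_ge ha h1 h2 hb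
  have hα := h.alpha_pos
  have : 0 ≤ α / 2 * ((b.1 - a.1) ^ 2 + (Real.sqrt (b.2 / a.2) - 1) ^ 2 * a.2) := by positivity
  linarith

/-- Coercivity, from integrating the quadratic upper bound for `log ρ` based at `0`. -/
theorem gaussianFreeEnergy_lower_bound (h : IsLogConcaveTarget ρ α β) {a : ℝ × ℝ}
    (ha : 0 < a.2) :
    -(Real.log a.2 / 2) - Real.log (ρ 0) - deriv (fun x => Real.log (ρ x)) 0 * a.1 +
      α / 2 * (a.1 ^ 2 + a.2) ≤ gaussianFreeEnergy ρ a := by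
  set d := deriv (fun x => Real.log (ρ x)) 0 with hd
  have k0 : ExpGrowth fun _ : ℝ => Real.log (ρ 0) + d * a.1 := .const _
  have k1 : ExpGrowth fun x => d * (x - a.1) := (ExpGrowth.sub_const _).const_mul _
  have k2 : ExpGrowth fun x => α / 2 * (a.1 + 1 * (x - a.1)) ^ 2 :=
    ((((ExpGrowth.const _).add ((ExpGrowth.sub_const _).const_mul _)).pow 2).const_mul _)
  have hI : ∫ x, Real.log (ρ x) ∂(gaussianOf a) ≤ Real.log (ρ 0) + d * a.1 -
      α / 2 * (a.1 ^ 2 + 1 ^ 2 * a.2) := by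
    calc ∫ x, Real.log (ρ x) ∂(gaussianOf a) ≤ ∫ x, (Real.log (ρ 0) + d * a.1 + d * (x - a.1) -
        α / 2 * (a.1 + 1 * (x - a.1)) ^ 2) ∂(gaussianOf a) := by
          refine integral_mono (h.expGrowth_log.integrable_gaussianOf a)
            (((k0.add k1).sub k2).integrable_gaussianOf a) fun x => ?_
          refine (h.log_le 0 x).trans (le_of_eq ?_)
          rw [← hd]; ring
      _ = _ := by
          rw [integral_sub ((k0.add k1).integrable_gaussianOf a) (k2.integrable_gaussianOf a),
            integral_add (k0.integrable_gaussianOf a) (k1.integrable_gaussianOf a),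
            integral_const_mul, integral_const_mul, integral_affine_sq ha, integral_sub_mean ha]
          simp
  unfold gaussianFreeEnergy
  linarith

theorem exists_isGaussianVIMinimizer (h : IsLogConcaveTarget ρ α β) :
    ∃ a, IsGaussianVIMinimizer ρ a := by
  have hα := h.alpha_pos
  set d := deriv (fun x => Real.log (ρ x)) 0 with hd
  set T := gaussianFreeEnergy ρ (0, 1) + Real.log (ρ 0) with hT
  set U := T + d ^ 2 / α - 1 / 2 - Real.log (α / 2) / 2 with hU
  -- A compact box containing the sublevel set of `(0, 1)`. Half of the quadratic in the mean
  -- absorbs the linear term, and half of the linear term in the variance absorbs the logarithm,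
  -- giving `α * (m^2 + C) / 4 ≤ U`; then `|m| ≤ m^2 + 1`. The logarithm itself keeps `C` away from
  -- `0`.
  set K : Set (ℝ × ℝ) := Set.Icc (-(4 * U / α + 1), Real.exp (-2 * (T + d ^ 2 / α)))
    (4 * U / α + 1, 4 * U / α) with hK
  have hsub : ∀ a : ℝ × ℝ, 0 < a.2 → gaussianFreeEnergy ρ a ≤ gaussianFreeEnergy ρ (0, 1) →
      a ∈ K := fun a ha hle => by
    have hlb := h.gaussianFreeEnergy_lower_bound ha
    rw [← hd] at hlb
    have hq : α * a.1 ^ 2 / 4 - d ^ 2 / α ≤ -(d * a.1) + α / 2 * a.1 ^ 2 := by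
      have : 0 ≤ (α * a.1 / 2 - d) ^ 2 / α := by positivity
      have e : (α * a.1 / 2 - d) ^ 2 / α = α * a.1 ^ 2 / 4 - d * a.1 + d ^ 2 / α := by
        field_simp; ring
      linarith
    have hl := Real.log_le_sub_one_of_pos (show 0 < α / 2 * a.2 by positivity)
    rw [Real.log_mul (by positivity) ha.ne'] at hl
    have hm0 : 0 ≤ α * a.1 ^ 2 := by positivity
    have hc0 : 0 < α * a.2 := by positivity
    have hsum : α * a.2 / 4 + α * a.1 ^ 2 / 4 ≤ U := by linarith
    have hC : a.2 ≤ 4 * U / α := by rw [le_div_iff₀ hα]; linarith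
    have hm : a.1 ^ 2 ≤ 4 * U / α := by rw [le_div_iff₀ hα]; linarith
    have hr : Real.exp (-2 * (T + d ^ 2 / α)) ≤ a.2 := by
      rw [← Real.le_log_iff_exp_le ha]
      linarith
    refine ⟨⟨?_, hr⟩, ⟨?_, hC⟩⟩
    · simp only; nlinarith
    · simp only; nlinarith
  have hpos : ∀ a ∈ K, 0 < a.2 := fun a ha => (Real.exp_pos _).trans_le ha.1.2
  have hcont : ContinuousOn (gaussianFreeEnergy ρ) K := fun a ha =>
    (h.hasFDerivAt_gaussianFreeEnergy (hpos a ha)).continuousAt.continuousWithinAt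
  obtain ⟨a, haK, hmin⟩ := (isCompact_Icc : IsCompact K).exists_isMinOn
    ⟨(0, 1), hsub (0, 1) one_pos le_rfl⟩ hcont
  refine ⟨a, (h.isGaussianVIMinimizer_iff a).2 ⟨hpos a haK, fun b hb => ?_⟩⟩
  rcases le_total (gaussianFreeEnergy ρ b) (gaussianFreeEnergy ρ (0, 1)) with hle | hle
  · exact hmin (hsub b hb hle)
  · exact (hmin (hsub (0, 1) one_pos le_rfl)).trans hle

theorem existsUnique_isGaussianVIMinimizer (h : IsLogConcaveTarget ρ α β) :
    ∃! a, IsGaussianVIMinimizer ρ a := by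
  obtain ⟨a, ha⟩ := h.exists_isGaussianVIMinimizer
  refine ⟨a, ha, fun b hb => ?_⟩
  have hα := h.alpha_pos
  have ha0 : 0 < a.2 := ha.1
  have hb0 : 0 < b.2 := hb.1
  obtain ⟨h1, h2⟩ := h.stationary_of_isGaussianVIMinimizer ha
  have h3 := h.gaussianFreeEnergy_ge ha0 h1 h2 hb0
  have h4 := ((h.isGaussianVIMinimizer_iff b).1 hb).2 a ha0
  have h5 : α / 2 * ((b.1 - a.1) ^ 2 + (Real.sqrt (b.2 / a.2) - 1) ^ 2 * a.2) ≤ 0 := by linarith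
  have h6 : (b.1 - a.1) ^ 2 + (Real.sqrt (b.2 / a.2) - 1) ^ 2 * a.2 ≤ 0 :=
    nonpos_of_mul_nonpos_right h5 (by positivity)
  have hp := mul_nonneg (sq_nonneg (Real.sqrt (b.2 / a.2) - 1)) ha0.le
  have h7 : (b.1 - a.1) ^ 2 = 0 := by linarith [sq_nonneg (b.1 - a.1)]
  have h8 : (Real.sqrt (b.2 / a.2) - 1) ^ 2 = 0 := by
    have : (Real.sqrt (b.2 / a.2) - 1) ^ 2 * a.2 = 0 := by linarith
    exact (mul_eq_zero.1 this).resolve_right ha0.ne'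
  have h9 : Real.sqrt (b.2 / a.2) = 1 := by linarith [pow_eq_zero_iff (two_ne_zero) |>.1 h8]
  rw [Real.sqrt_eq_one, div_eq_one_iff_eq ha0.ne'] at h9
  exact Prod.ext (by linarith [pow_eq_zero_iff (two_ne_zero) |>.1 h7]) h9

end IsLogConcaveTarget

/-! ### The Jacobian at the minimizer and its spectrum. -/

/-- A real `2 × 2` system with off-diagonal entries of the same sign, trace `-τ` and determinant
`δ > 0`, has real eigenvalues, and minus the largest one is comparable to `δ / τ`. -/
theorem exists_top_eigenvalue (L : Module.End ℝ (ℝ × ℝ)) {p q r w τ δ : ℝ}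
    (hL : ∀ v, L v = (p * v.1 + q * v.2, r * v.1 + w * v.2)) (hqr : 0 ≤ q * r)
    (hτ : -(p + w) = τ) (hδ : p * w - q * r = δ) (hτ0 : 0 < τ) (hδ0 : 0 < δ) :
    ∃ l, L.charpoly.Splits ∧ IsGreatest {μ : ℝ | L.HasEigenvalue μ} l ∧
      δ / τ ≤ -l ∧ -l ≤ 2 * (δ / τ) := by
  set D := (p - w) ^ 2 + 4 * (q * r) with hD
  have hD0 : 0 ≤ D := by positivity
  set s := Real.sqrt D with hs
  have hs0 : 0 ≤ s := Real.sqrt_nonneg D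
  have hs2 : s ^ 2 = D := Real.sq_sqrt hD0
  set l := (p + w + s) / 2 with hl
  set l' := (p + w - s) / 2 with hl'
  have hsum : l + l' = p + w := by rw [hl, hl']; ring
  have hprod : l * l' = p * w - q * r := by
    rw [hl, hl']; nlinarith
  have hM : LinearMap.toMatrix (Module.Basis.finTwoProd ℝ) (Module.Basis.finTwoProd ℝ) L =
      !![p, q; r, w] := by
    ext i j
    fin_cases i <;> fin_cases j <;> simp [LinearMap.toMatrix_apply, hL]
  have hcp : L.charpoly = (Polynomial.X - Polynomial.C l) * (Polynomial.X - Polynomial.C l') := by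
    rw [← LinearMap.charpoly_toMatrix L (Module.Basis.finTwoProd ℝ), hM, Matrix.charpoly_fin_two,
      Matrix.trace_fin_two_of, Matrix.det_fin_two_of, ← hsum, ← hprod]
    simp only [Polynomial.C_add, Polynomial.C_mul]
    ring
  have hroot : ∀ μ, L.HasEigenvalue μ ↔ μ = l ∨ μ = l' := fun μ => by
    rw [Module.End.hasEigenvalue_iff_isRoot_charpoly, hcp, Polynomial.IsRoot.def,
      Polynomial.eval_mul, mul_eq_zero]
    simp [sub_eq_zero]
  have hll : l' ≤ l := by rw [hl, hl']; linarith
  have hneg : l < 0 := by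
    by_contra hn
    push Not at hn
    nlinarith
  have hneg' : l' < 0 := by linarith
  refine ⟨l, ?_, ⟨(hroot l).2 (Or.inl rfl), fun μ hμ => ?_⟩, ?_, ?_⟩
  · rw [hcp]
    exact (Polynomial.Splits.X_sub_C l).mul (Polynomial.Splits.X_sub_C l')
  · rcases (hroot μ).1 hμ with rfl | rfl
    · exact le_rfl
    · exact hll
  -- Both remaining bounds use `δ = (-l) * (-l')` together with `τ / 2 ≤ -l' ≤ τ`.
  · rw [div_le_iff₀ hτ0]; nlinarith
  · rw [← mul_div_assoc, le_div_iff₀ hτ0]; nlinarith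

namespace IsLogConcaveTarget

variable {ρ : ℝ → ℝ} {α β : ℝ}

/-- Product rule and Stein's identities: `E[(log ρ)'] = 0` removes the term from differentiating the
prefactor `C` in the first component, and `E[(log ρ)''] = -1/C` evaluates the rest up to the two
weighted moments. -/
theorem hasFDerivAt_fisherRaoField (h : IsLogConcaveTarget ρ α β) {a : ℝ × ℝ} (ha : 0 < a.2)
    (h1 : ∫ θ, deriv (fun x => Real.log (ρ x)) θ ∂(gaussianOf a) = 0)
    (h2 : a.2 * ∫ θ, deriv (deriv (fun x => Real.log (ρ x))) θ ∂(gaussianOf a) = -1) :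
    ∃ L : ℝ × ℝ →L[ℝ] ℝ × ℝ, HasFDerivAt (fisherRaoField ρ) L a ∧ ∀ v, L v =
      ((-1) * v.1 + (-(∫ θ, -deriv (deriv fun x => Real.log (ρ x)) θ * (θ - a.1)
          ∂(gaussianOf a)) / 2) * v.2,
        (-(a.2 * ∫ θ, -deriv (deriv fun x => Real.log (ρ x)) θ * (θ - a.1) ∂(gaussianOf a))) * v.1 +
        (-(1 + ∫ θ, -deriv (deriv fun x => Real.log (ρ x)) θ * (θ - a.1) ^ 2
          ∂(gaussianOf a)) / 2) * v.2) := by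
  have d1 := hasFDerivAt_integral_gaussianOf h.expGrowth_deriv_log ha
  have d2 := hasFDerivAt_integral_gaussianOf h.expGrowth_deriv2_log ha
  rw [stein_identity h.hasDerivAt_deriv_log h.expGrowth_deriv_log h.expGrowth_deriv2_log ha,
    stein_identity_sq h.hasDerivAt_deriv_log h.expGrowth_deriv_log h.expGrowth_deriv2_log ha] at d1
  have g2 := h.expGrowth_deriv2_log
  set f2 := deriv (deriv fun x => Real.log (ρ x)) with hf2
  have ds := hasFDerivAt_snd (𝕜 := ℝ) (E := ℝ) (F := ℝ) (p := a)
  have e2 : ∫ θ, f2 θ ∂(gaussianOf a) = -(1 / a.2) := by field_simp; linarith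
  have eT : ∫ θ, f2 θ * ((θ - a.1) / a.2) ∂(gaussianOf a) =
      -(∫ θ, -f2 θ * (θ - a.1) ∂(gaussianOf a)) / a.2 := by
    rw [← integral_neg, ← integral_div]; congr 1; funext x; ring
  have eS : ∫ θ, f2 θ * (((θ - a.1) ^ 2 / a.2 ^ 2 - 1 / a.2) / 2) ∂(gaussianOf a) =
      (1 - ∫ θ, -f2 θ * (θ - a.1) ^ 2 ∂(gaussianOf a)) / (2 * a.2 ^ 2) := by
    have i1 : ExpGrowth fun θ => -f2 θ * (θ - a.1) ^ 2 := g2.neg.mul ((ExpGrowth.sub_const _).pow 2)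
    have e : (fun θ => f2 θ * (((θ - a.1) ^ 2 / a.2 ^ 2 - 1 / a.2) / 2)) = fun θ =>
        (-(a.2 * f2 θ) - -f2 θ * (θ - a.1) ^ 2) / (2 * a.2 ^ 2) := by
      funext θ; field_simp; ring
    rw [e, integral_div, integral_sub ((g2.const_mul a.2).neg.integrable_gaussianOf a)
      (i1.integrable_gaussianOf a), integral_neg, integral_const_mul, h2, neg_neg]
  rw [eT, e2] at d1
  rw [eT, eS] at d2
  refine ⟨_, (ds.mul d1).prodMk (ds.add ((ds.mul d2).mul ds)), fun v => ?_⟩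
  simp only [h1, e2]
  ext
  · simp
    field_simp
  · simp [e2]
    field_simp
    ring

/-- The variance of the Hessian-weighted Gaussian at a stationary point is nonnegative. -/
theorem weighted_variance_le (h : IsLogConcaveTarget ρ α β) {a : ℝ × ℝ} (ha : 0 < a.2)
    (h2 : a.2 * ∫ θ, deriv (deriv (fun x => Real.log (ρ x))) θ ∂(gaussianOf a) = -1) (c : ℝ) :
    0 ≤ (∫ θ, -deriv (deriv fun x => Real.log (ρ x)) θ * (θ - a.1) ^ 2 ∂(gaussianOf a)) -
        a.2 * (∫ θ, -deriv (deriv fun x => Real.log (ρ x)) θ * (θ - a.1) ∂(gaussianOf a)) ^ 2 ∧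
      (∫ θ, -deriv (deriv fun x => Real.log (ρ x)) θ * (θ - a.1) ^ 2 ∂(gaussianOf a)) -
        a.2 * (∫ θ, -deriv (deriv fun x => Real.log (ρ x)) θ * (θ - a.1) ∂(gaussianOf a)) ^ 2 ≤
      ∫ θ, -deriv (deriv fun x => Real.log (ρ x)) θ * (θ - a.1 - c) ^ 2 ∂(gaussianOf a) := by
  have hpos : ∀ x, 0 ≤ -deriv (deriv fun x => Real.log (ρ x)) x := fun x =>
    h.alpha_pos.le.trans (h.strongly_logconcave x)
  have g2 := h.expGrowth_deriv2_log.neg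
  have e2 : ∫ θ, -deriv (deriv fun x => Real.log (ρ x)) θ ∂(gaussianOf a) = 1 / a.2 := by
    rw [integral_neg]; field_simp; linarith
  set W := fun θ => -deriv (deriv fun x => Real.log (ρ x)) θ with hW
  set S := ∫ θ, W θ * (θ - a.1) ^ 2 ∂(gaussianOf a) with hS
  set T := ∫ θ, W θ * (θ - a.1) ∂(gaussianOf a) with hT
  have key : ∀ c, ∫ θ, W θ * (θ - a.1 - c) ^ 2 ∂(gaussianOf a) = S - 2 * c * T + c ^ 2 / a.2 := by
    intro c
    have i1 : ExpGrowth fun θ => W θ * (θ - a.1) ^ 2 := g2.mul ((ExpGrowth.sub_const _).pow 2)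
    have i2 : ExpGrowth fun θ => 2 * c * (W θ * (θ - a.1)) :=
      (g2.mul (ExpGrowth.sub_const _)).const_mul _
    have i3 : ExpGrowth fun θ => c ^ 2 * W θ := g2.const_mul _
    have e : (fun θ => W θ * (θ - a.1 - c) ^ 2) = fun θ =>
        W θ * (θ - a.1) ^ 2 - 2 * c * (W θ * (θ - a.1)) + c ^ 2 * W θ := by
      funext θ; ring
    rw [e, integral_add ((i1.sub i2).integrable_gaussianOf a) (i3.integrable_gaussianOf a),
      integral_sub (i1.integrable_gaussianOf a) (i2.integrable_gaussianOf a),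
      integral_const_mul, integral_const_mul, e2, ← hS, ← hT]
    ring
  -- The shift `a.2 * T` is the mean of `θ - a.1` under the probability density `a.2 * W`; any other
  -- centre `c` adds `(c - a.2 * T)^2 / a.2`.
  have h0 : 0 ≤ ∫ θ, W θ * (θ - a.1 - a.2 * T) ^ 2 ∂(gaussianOf a) :=
    integral_nonneg fun θ => mul_nonneg (hpos θ) (sq_nonneg _)
  have hk : S - 2 * (a.2 * T) * T + (a.2 * T) ^ 2 / a.2 = S - a.2 * T ^ 2 := by
    field_simp; ring
  refine ⟨by rw [key, hk] at h0; exact h0, ?_⟩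
  rw [key c]
  have : 0 ≤ (c - a.2 * T) ^ 2 / a.2 := by positivity
  have e : (c - a.2 * T) ^ 2 / a.2 = c ^ 2 / a.2 - 2 * c * T + a.2 * T ^ 2 := by
    field_simp; ring
  linarith

/-- The largest Jacobian eigenvalue at a stationary point, up to a factor two, in terms of the
moments of the Hessian-weighted Gaussian. -/
theorem exists_isTopJacobianEigenvalue (h : IsLogConcaveTarget ρ α β) {a : ℝ × ℝ} (ha : 0 < a.2)
    (h1 : ∫ θ, deriv (fun x => Real.log (ρ x)) θ ∂(gaussianOf a) = 0)
    (h2 : a.2 * ∫ θ, deriv (deriv (fun x => Real.log (ρ x))) θ ∂(gaussianOf a) = -1) {S : ℝ}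
    (hS : ∫ θ, -deriv (deriv fun x => Real.log (ρ x)) θ * (θ - a.1) ^ 2 ∂(gaussianOf a) = S)
    (c : ℝ) :
    ∃ l, IsTopJacobianEigenvalue ρ a l ∧ 1 / (3 + S) ≤ -l ∧
      -l ≤ 2 * ((1 + ∫ θ, -deriv (deriv fun x => Real.log (ρ x)) θ * (θ - a.1 - c) ^ 2
        ∂(gaussianOf a)) / (3 + S)) := by
  obtain ⟨L, hL, hLv⟩ := h.hasFDerivAt_fisherRaoField ha h1 h2
  obtain ⟨hv, hv'⟩ := h.weighted_variance_le ha h2 c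
  have hS0 : 0 ≤ S := by
    rw [← hS]
    exact integral_nonneg fun θ =>
      mul_nonneg (h.alpha_pos.le.trans (h.strongly_logconcave θ)) (sq_nonneg _)
  rw [hS] at hLv hv hv'
  set T := ∫ θ, -deriv (deriv fun x => Real.log (ρ x)) θ * (θ - a.1) ∂(gaussianOf a) with hT
  set v' := ∫ θ, -deriv (deriv fun x => Real.log (ρ x)) θ * (θ - a.1 - c) ^ 2 ∂(gaussianOf a)
  obtain ⟨l, hsp, hgr, hlo, hup⟩ := exists_top_eigenvalue L.toLinearMap (τ := (3 + S) / 2)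
    (δ := (1 + (S - a.2 * T ^ 2)) / 2) hLv
    (by nlinarith [mul_nonneg ha.le (sq_nonneg T)]) (by ring) (by ring) (by linarith) (by linarith)
  have e : (1 + (S - a.2 * T ^ 2)) / 2 / ((3 + S) / 2) = (1 + (S - a.2 * T ^ 2)) / (3 + S) := by
    field_simp
  rw [e] at hlo hup
  have h3 : 0 < 3 + S := by linarith
  refine ⟨l, ⟨hL.differentiableAt, ?_, ?_⟩, le_trans ?_ hlo, hup.trans ?_⟩
  · rw [fisherRaoJacobian, hL.fderiv]; exact hsp
  · rw [fisherRaoJacobian, hL.fderiv]; exact hgr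
  · exact div_le_div_of_nonneg_right (by linarith) h3.le
  · exact mul_le_mul_of_nonneg_left (div_le_div_of_nonneg_right (by linarith) h3.le) two_pos.le

end IsLogConcaveTarget

/-! ### The entropy bound on the weighted second moment, and the convergence rate. -/

/-- The factor halves the Gaussian exponent, that is, doubles the variance; the normalization
changes by `√2`. -/
theorem gaussDensity_mul_exp {a : ℝ × ℝ} (ha : 0 < a.2) (x : ℝ) :
    gaussDensity a x * Real.exp ((x - a.1) ^ 2 / (4 * a.2)) =
      Real.sqrt 2 * gaussDensity (a.1, 2 * a.2) x := by
  have hpi := Real.pi_pos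
  have h2 : Real.sqrt (2 * Real.pi * (2 * a.2)) = Real.sqrt 2 * Real.sqrt (2 * Real.pi * a.2) := by
    rw [← Real.sqrt_mul two_pos.le]; congr 1; ring
  unfold gaussDensity
  rw [mul_assoc, ← Real.exp_add, h2, mul_inv, ← mul_assoc, ← mul_assoc,
    mul_inv_cancel₀ (by positivity), one_mul]
  congr 2
  field_simp
  ring

theorem integrable_exp_sq_gaussianOf {a : ℝ × ℝ} (ha : 0 < a.2) :
    Integrable (fun x => Real.exp ((x - a.1) ^ 2 / (4 * a.2))) (gaussianOf a) := by
  rw [integrable_gaussianOf_iff ha]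
  simp only [gaussDensity_mul_exp ha]
  have := (ExpGrowth.const (Real.sqrt 2)).integrable_density
    (a := (a.1, 2 * a.2)) (by simpa using ha)
  simpa only [mul_comm] using this

theorem integral_exp_sq_gaussianOf {a : ℝ × ℝ} (ha : 0 < a.2) :
    ∫ x, Real.exp ((x - a.1) ^ 2 / (4 * a.2)) ∂(gaussianOf a) = Real.sqrt 2 := by
  rw [integral_gaussianOf ha]
  simp only [gaussDensity_mul_exp ha]
  have := integral_gaussianOf (a := (a.1, 2 * a.2)) (by simpa using ha) (fun _ => (1 : ℝ))
  simp only [integral_const, probReal_univ, smul_eq_mul, mul_one] at this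
  rw [integral_const_mul, ← this, mul_one]

/-- Young's inequality for the entropy function. -/
theorem mul_le_mul_log_add_exp {w : ℝ} (hw : 0 < w) (y : ℝ) :
    w * y ≤ w * Real.log w - w + Real.exp y := by
  have h := Real.add_one_le_exp (y - Real.log w)
  rw [Real.exp_sub, Real.exp_log hw, le_div_iff₀ hw] at h
  linarith

namespace IsLogConcaveTarget

variable {ρ : ℝ → ℝ} {α β : ℝ}

/-- The weighted second moment grows at most logarithmically in the condition number. -/
theorem weighted_second_moment_le (h : IsLogConcaveTarget ρ α β) {a : ℝ × ℝ} (ha : 0 < a.2)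
    (h2 : a.2 * ∫ θ, deriv (deriv (fun x => Real.log (ρ x))) θ ∂(gaussianOf a) = -1) :
    ∫ θ, -deriv (deriv fun x => Real.log (ρ x)) θ * (θ - a.1) ^ 2 ∂(gaussianOf a) ≤
      4 + 4 * Real.log (β / α) := by
  have hα := h.alpha_pos
  have hlo := h.strongly_logconcave
  have hup := h.smooth
  have hβ : 0 < β := hα.trans_le ((hlo 0).trans (hup 0))
  have g2 := h.expGrowth_deriv2_log.neg
  have e2 : ∫ θ, -deriv (deriv fun x => Real.log (ρ x)) θ ∂(gaussianOf a) = 1 / a.2 := by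
    rw [integral_neg]; field_simp; linarith
  set W := fun θ => -deriv (deriv fun x => Real.log (ρ x)) θ with hW
  -- Since `α ≤ E[W] = 1/C`, the relative density satisfies `C * W ≤ C * β ≤ β / α`.
  have hαC : α * a.2 ≤ 1 := by
    have : ∫ _θ, α ∂(gaussianOf a) ≤ ∫ θ, W θ ∂(gaussianOf a) :=
      integral_mono (integrable_const _) (g2.integrable_gaussianOf a) hlo
    rw [e2] at this
    simp only [integral_const, probReal_univ, smul_eq_mul, one_mul] at this
    rwa [le_div_iff₀ ha] at this
  have hκ : Real.log (a.2 * β) ≤ Real.log (β / α) := by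
    apply Real.log_le_log (by positivity)
    rw [le_div_iff₀ hα]
    nlinarith
  have i1 : ExpGrowth fun θ => W θ * (θ - a.1) ^ 2 := g2.mul ((ExpGrowth.sub_const _).pow 2)
  have i2 : ExpGrowth fun θ => a.2 * (Real.log (β / α) - 1) * W θ := g2.const_mul _
  have hmono : ∫ θ, W θ * (θ - a.1) ^ 2 / 4 ∂(gaussianOf a) ≤
      ∫ θ, (a.2 * (Real.log (β / α) - 1) * W θ + Real.exp ((θ - a.1) ^ 2 / (4 * a.2)))
        ∂(gaussianOf a) := by
    refine integral_mono (i1.div_const 4 |>.integrable_gaussianOf a)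
      ((i2.integrable_gaussianOf a).add (integrable_exp_sq_gaussianOf ha)) fun θ => ?_
    have hWpos : 0 < W θ := hα.trans_le (hlo θ)
    have hw : 0 < a.2 * W θ := by positivity
    -- Young's inequality for the weight `C * W`, of mean one, against an exponent small enough to
    -- have a finite exponential moment.
    have hy := mul_le_mul_log_add_exp hw ((θ - a.1) ^ 2 / (4 * a.2))
    have hlog : Real.log (a.2 * W θ) ≤ Real.log (β / α) :=
      (Real.log_le_log hw (mul_le_mul_of_nonneg_left (hup θ) ha.le)).trans hκ
    have hm := mul_le_mul_of_nonneg_left hlog hw.le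
    have e : a.2 * W θ * ((θ - a.1) ^ 2 / (4 * a.2)) = W θ * (θ - a.1) ^ 2 / 4 := by
      field_simp
    simp only
    linarith
  rw [integral_div, integral_add (i2.integrable_gaussianOf a) (integrable_exp_sq_gaussianOf ha),
    integral_const_mul, e2, integral_exp_sq_gaussianOf ha] at hmono
  have e : a.2 * (Real.log (β / α) - 1) * (1 / a.2) = Real.log (β / α) - 1 := by field_simp
  rw [e] at hmono
  have hs2 : Real.sqrt 2 ≤ 2 := Real.sqrt_le_iff.2 (by norm_num)
  linarith

theorem exists_isTopJacobianEigenvalue_ge (h : IsLogConcaveTarget ρ α β) {a : ℝ × ℝ}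
    (hmin : IsGaussianVIMinimizer ρ a) :
    ∃ l : ℝ, IsTopJacobianEigenvalue ρ a l ∧ l < 0 ∧
      -l ≥ 1 / ((7 + 4 / Real.sqrt Real.pi) * (1 + Real.log (β / α))) := by
  have ha : 0 < a.2 := hmin.1
  have hα := h.alpha_pos
  obtain ⟨h1, h2⟩ := h.stationary_of_isGaussianVIMinimizer hmin
  obtain ⟨l, hl, hlo, -⟩ := h.exists_isTopJacobianEigenvalue ha h1 h2 rfl 0
  have hS := h.weighted_second_moment_le ha h2
  have hS0 : 0 ≤ ∫ θ, -deriv (deriv fun x => Real.log (ρ x)) θ * (θ - a.1) ^ 2 ∂(gaussianOf a) :=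
    integral_nonneg fun θ =>
      mul_nonneg (h.alpha_pos.le.trans (h.strongly_logconcave θ)) (sq_nonneg _)
  have hlog : 0 ≤ Real.log (β / α) := Real.log_nonneg <| by
    rw [le_div_iff₀ hα, one_mul]
    exact (h.strongly_logconcave 0).trans (h.smooth 0)
  have hpi : 0 ≤ 4 / Real.sqrt Real.pi := by positivity
  -- Here `3 + S ≤ 7 + 4 * log (β/α)`, so the summand `4 / √π` is slack.
  have hge : 1 / ((7 + 4 / Real.sqrt Real.pi) * (1 + Real.log (β / α))) ≤ -l := by
    refine le_trans ?_ hlo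
    apply one_div_le_one_div_of_le (by linarith)
    nlinarith
  have : 0 < 1 / ((7 + 4 / Real.sqrt Real.pi) * (1 + Real.log (β / α))) := by positivity
  exact ⟨l, hl, by linarith, hge⟩

end IsLogConcaveTarget

/-! ### The smoothed bump and its moments under the standard Gaussian. -/

/-- The Gaussian centred at `θ` with standard deviation `σ` gives this mass to
`(γ - σ, γ + σ)`. -/
noncomputable def bumpMass (γ σ θ : ℝ) : ℝ :=
  (gaussianOf (θ, σ ^ 2)).real (Set.Ioo (γ - σ) (γ + σ))

theorem le_setIntegral_Ioo {f : ℝ → ℝ} {p q c : ℝ} (hpq : p ≤ q)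
    (hf : IntegrableOn f (Set.Ioo p q)) (h : ∀ x ∈ Set.Ioo p q, c ≤ f x) :
    (q - p) * c ≤ ∫ x in Set.Ioo p q, f x := by
  have := setIntegral_mono_on (integrableOn_const (by simp)) hf measurableSet_Ioo h
  rwa [setIntegral_const, Measure.real, Real.volume_Ioo, ENNReal.toReal_ofReal (by linarith),
    smul_eq_mul] at this

theorem setIntegral_Ioo_le {f : ℝ → ℝ} {p q c : ℝ} (hpq : p ≤ q)
    (hf : IntegrableOn f (Set.Ioo p q)) (h : ∀ x ∈ Set.Ioo p q, f x ≤ c) :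
    ∫ x in Set.Ioo p q, f x ≤ (q - p) * c := by
  have := setIntegral_mono_on hf (integrableOn_const (by simp)) measurableSet_Ioo h
  rwa [setIntegral_const, Measure.real, Real.volume_Ioo, ENNReal.toReal_ofReal (by linarith),
    smul_eq_mul] at this

theorem integrable_gaussDensity {a : ℝ × ℝ} (ha : 0 < a.2) : Integrable (gaussDensity a) := by
  simpa using (ExpGrowth.const 1).integrable_density ha

theorem bumpMass_eq_setIntegral {σ : ℝ} (hσ : 0 < σ) (γ θ : ℝ) :
    bumpMass γ σ θ = ∫ x in Set.Ioo (γ - σ) (γ + σ), gaussDensity (θ, σ ^ 2) x := by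
  rw [bumpMass, ← integral_indicator_one measurableSet_Ioo,
    integral_gaussianOf (by simpa using pow_pos hσ 2), ← integral_indicator measurableSet_Ioo]
  congr 1
  funext x
  by_cases hx : x ∈ Set.Ioo (γ - σ) (γ + σ) <;> simp [hx]

/-- The kernel is symmetric in `θ` and `x`, so the convolution at `θ` is an average over `N(θ, σ²)`.
-/
theorem smoothedBump_eq {σ : ℝ} (hσ : 0 < σ) (α β γ θ : ℝ) :
    smoothedBump α β γ σ θ = α + (β - α) * bumpMass γ σ θ := by
  have h2 : 0 < ((θ, σ ^ 2) : ℝ × ℝ).2 := pow_pos hσ 2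
  have hi : Integrable (Set.indicator (Set.Ioo (γ - σ) (γ + σ)) (1 : ℝ → ℝ))
      (gaussianOf (θ, σ ^ 2)) := (integrable_const (1 : ℝ)).indicator measurableSet_Ioo
  have e : ∫ x, (α + (β - α) * Set.indicator (Set.Ioo (γ - σ) (γ + σ)) (1 : ℝ → ℝ) x)
      ∂(gaussianOf (θ, σ ^ 2)) = α + (β - α) * bumpMass γ σ θ := by
    rw [integral_add (integrable_const _) (hi.const_mul _), integral_const_mul,
      integral_indicator_one measurableSet_Ioo, bumpMass]
    simp
  rw [← e, integral_gaussianOf h2, smoothedBump]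
  congr 1
  funext x
  have hs : Real.sqrt (2 * Real.pi * σ ^ 2) = σ * Real.sqrt (2 * Real.pi) := by
    rw [Real.sqrt_mul (by positivity), Real.sqrt_sq hσ.le, mul_comm]
  have hd : Real.exp (-(θ - x) ^ 2 / (2 * σ ^ 2)) / (σ * Real.sqrt (2 * Real.pi)) =
      gaussDensity (θ, σ ^ 2) x := by
    simp only [gaussDensity, hs]
    rw [div_eq_inv_mul, show (θ - x) ^ 2 = (x - θ) ^ 2 by ring]
  rw [hd, mul_comm]
  by_cases hx : γ - σ < x ∧ x < γ + σ
  · simp [hx]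
  · have : x ∉ Set.Ioo (γ - σ) (γ + σ) := hx
    simp [hx]

theorem bumpMass_nonneg (γ σ θ : ℝ) : 0 ≤ bumpMass γ σ θ := measureReal_nonneg

theorem bumpMass_le_one (γ σ θ : ℝ) : bumpMass γ σ θ ≤ 1 := measureReal_le_one

theorem continuous_bumpMass {σ : ℝ} (hσ : 0 < σ) (γ : ℝ) : Continuous (bumpMass γ σ) := by
  have hg : ExpGrowth (Set.indicator (Set.Ioo (γ - σ) (γ + σ)) (1 : ℝ → ℝ)) :=
    (ExpGrowth.const 1).mono (measurable_one.indicator measurableSet_Ioo) fun x => by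
      by_cases hx : x ∈ Set.Ioo (γ - σ) (γ + σ) <;> simp [hx]
  have e : bumpMass γ σ = (fun b => ∫ x, Set.indicator (Set.Ioo (γ - σ) (γ + σ)) (1 : ℝ → ℝ) x
      ∂(gaussianOf b)) ∘ fun θ => (θ, σ ^ 2) := by
    funext θ
    simp only [Function.comp, bumpMass, integral_indicator_one measurableSet_Ioo]
  rw [e]
  refine continuous_iff_continuousAt.2 fun θ => ?_
  exact ContinuousAt.comp (f := fun θ : ℝ => (θ, σ ^ 2))
    (hasFDerivAt_integral_gaussianOf hg (a := (θ, σ ^ 2)) (pow_pos hσ 2)).continuousAt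
    (by fun_prop)

theorem expGrowth_bumpMass {σ : ℝ} (hσ : 0 < σ) (γ : ℝ) : ExpGrowth (bumpMass γ σ) :=
  (ExpGrowth.const 1).mono (continuous_bumpMass hσ γ).measurable fun x => by
    rw [abs_of_nonneg (bumpMass_nonneg _ _ _), abs_one]
    exact bumpMass_le_one _ _ _

theorem sqrt_two_pi_mul_sq {σ : ℝ} (hσ : 0 < σ) :
    Real.sqrt (2 * Real.pi * σ ^ 2) = Real.sqrt (2 * Real.pi) * σ := by
  rw [Real.sqrt_mul (by positivity), Real.sqrt_sq hσ.le]

theorem one_le_sqrt_two_pi : 1 ≤ Real.sqrt (2 * Real.pi) :=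
  Real.one_le_sqrt.2 (by linarith [Real.pi_gt_three])

/-- For `x` in the bump, `(θ - γ)^2 ≤ 2 * (x - θ)^2 + 2 * σ^2`: half of the Gaussian decay survives,
at the price of `exp (1/2)`. -/
theorem bumpMass_le_exp {σ : ℝ} (hσ : 0 < σ) (γ θ : ℝ) :
    bumpMass γ σ θ ≤ 2 * Real.exp (1 / 2) * Real.exp (-(θ - γ) ^ 2 / (4 * σ ^ 2)) := by
  have hs := one_le_sqrt_two_pi
  have h2 : 0 < ((θ, σ ^ 2) : ℝ × ℝ).2 := pow_pos hσ 2
  rw [bumpMass_eq_setIntegral hσ]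
  refine (setIntegral_Ioo_le (c := σ⁻¹ * (Real.exp (1 / 2) *
    Real.exp (-(θ - γ) ^ 2 / (4 * σ ^ 2)))) (by linarith)
    (integrable_gaussDensity h2).integrableOn fun x hx => ?_).trans (le_of_eq ?_)
  · rw [gaussDensity]
    simp only [sqrt_two_pi_mul_sq hσ]
    refine mul_le_mul ?_ ?_ (Real.exp_pos _).le (by positivity)
    · exact inv_anti₀ hσ (le_mul_of_one_le_left hσ.le hs)
    · rw [← Real.exp_add]
      apply Real.exp_le_exp.2
      have hx2 : (x - γ) ^ 2 ≤ σ ^ 2 := by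
        apply sq_le_sq'
        · linarith [hx.1]
        · linarith [hx.2]
      have e : 1 / 2 + -(θ - γ) ^ 2 / (4 * σ ^ 2) = (2 * σ ^ 2 - (θ - γ) ^ 2) / (4 * σ ^ 2) := by
        field_simp
        ring
      rw [e, div_le_div_iff₀ (by positivity) (by positivity)]
      have : 0 ≤ 2 * (x - θ) ^ 2 + 2 * σ ^ 2 - (θ - γ) ^ 2 := by
        nlinarith [sq_nonneg ((x - θ) + (x - γ))]
      nlinarith [mul_nonneg (sq_nonneg σ) this]
  · field_simp; ring

/-- Every point of the bump lies within `2 * σ` of such a `θ`, so the Gaussian exponent is at least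
`-2`. -/
theorem le_bumpMass {σ : ℝ} (hσ : 0 < σ) {γ θ : ℝ} (hθ : |θ - γ| ≤ σ) :
    2 * (Real.sqrt (2 * Real.pi))⁻¹ * Real.exp (-2) ≤ bumpMass γ σ θ := by
  have hs := one_le_sqrt_two_pi
  have h2 : 0 < ((θ, σ ^ 2) : ℝ × ℝ).2 := pow_pos hσ 2
  rw [bumpMass_eq_setIntegral hσ]
  refine le_trans (le_of_eq ?_) (le_setIntegral_Ioo (c := (Real.sqrt (2 * Real.pi) * σ)⁻¹ *
    Real.exp (-2)) (by linarith) (integrable_gaussDensity h2).integrableOn fun x hx => ?_)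
  · field_simp; ring
  · rw [gaussDensity]
    simp only [sqrt_two_pi_mul_sq hσ]
    refine mul_le_mul_of_nonneg_left (Real.exp_le_exp.2 ?_) (by positivity)
    rw [abs_le] at hθ
    have : (x - θ) ^ 2 ≤ (2 * σ) ^ 2 := by
      apply sq_le_sq'
      · linarith [hx.1]
      · linarith [hx.2]
    rw [le_div_iff₀ (by positivity)]
    linarith

theorem gaussDensity_zero_one (x : ℝ) :
    gaussDensity (0, 1) x = (Real.sqrt (2 * Real.pi))⁻¹ * Real.exp (-x ^ 2 / 2) := by
  simp [gaussDensity]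

/-- Lower bound for the standard Gaussian average of the bump of width `1 / γ` at `γ`. -/
theorem le_integral_bumpMass {γ σ : ℝ} (hσ : 0 < σ) (hσ1 : σ ≤ 1) (hγσ : γ * σ = 1) :
    2 * (2 * (Real.sqrt (2 * Real.pi))⁻¹ * Real.exp (-2)) *
      ((Real.sqrt (2 * Real.pi))⁻¹ * Real.exp (-(3 / 2))) * σ * Real.exp (-γ ^ 2 / 2) ≤
    ∫ x, bumpMass γ σ x ∂(gaussianOf (0, 1)) := by
  have hγ : 0 < γ := by
    by_contra hn
    nlinarith
  have hi : Integrable fun x => gaussDensity (0, 1) x * bumpMass γ σ x :=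
    (expGrowth_bumpMass hσ γ).integrable_density (a := (0, 1)) one_pos
  rw [integral_gaussianOf (by simp)]
  refine le_trans (le_trans (le_of_eq ?_) (le_setIntegral_Ioo (p := γ - σ) (q := γ + σ)
    (c := ((Real.sqrt (2 * Real.pi))⁻¹ * (Real.exp (-(3 / 2)) * Real.exp (-γ ^ 2 / 2))) *
      (2 * (Real.sqrt (2 * Real.pi))⁻¹ * Real.exp (-2))) (by linarith) hi.integrableOn
        fun x hx => ?_)) (setIntegral_le_integral hi (ae_of_all _ fun x =>
          mul_nonneg (gaussDensity_pos (by simp) x).le (bumpMass_nonneg _ _ _)))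
  · ring
  · refine mul_le_mul ?_ (le_bumpMass hσ (abs_le.2 ⟨by linarith [hx.1], by linarith [hx.2]⟩))
      (by positivity) (gaussDensity_pos (by simp) x).le
    rw [gaussDensity_zero_one, ← Real.exp_add]
    refine mul_le_mul_of_nonneg_left (Real.exp_le_exp.2 ?_) (by positivity)
    -- With `γ * σ = 1` and `σ ≤ 1`, the right side is at most `γ^2 + 3`: at width `1 / γ` the
    -- density varies over the bump only by a bounded factor.
    have : x ^ 2 ≤ (γ + σ) ^ 2 := by
      apply sq_le_sq'
      · linarith [hx.1]
      · linarith [hx.2]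
    nlinarith

/-- The bump of width `1 / γ` at `γ` has a small second moment around `γ`. -/
theorem integral_bumpMass_mul_sq_le {γ σ : ℝ} (hσ : 0 < σ) (hσ1 : σ ≤ 1) (hγσ : γ * σ = 1) :
    ∫ x, bumpMass γ σ x * (x - γ) ^ 2 ∂(gaussianOf (0, 1)) ≤
      16 * Real.exp (1 / 2) * Real.exp 2 * σ * Real.exp (-γ ^ 2 / 2) := by
  have hs := one_le_sqrt_two_pi
  have hi : Integrable fun x => gaussDensity (0, 1) x * (bumpMass γ σ x * (x - γ) ^ 2) :=
    ((expGrowth_bumpMass hσ γ).mul ((ExpGrowth.sub_const _).pow 2)).integrable_density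
      (a := (0, 1)) one_pos
  have h2 : 0 < ((γ, (2 * σ) ^ 2) : ℝ × ℝ).2 := by simp only; positivity
  have hj : Integrable fun x => gaussDensity (γ, (2 * σ) ^ 2) x * (x - γ) ^ 2 :=
    ((ExpGrowth.sub_const γ).pow 2).integrable_density h2
  have hq : ∫ x, gaussDensity (γ, (2 * σ) ^ 2) x * (x - γ) ^ 2 = (2 * σ) ^ 2 := by
    have := integral_sub_mean_sq h2
    rwa [integral_gaussianOf h2] at this
  rw [integral_gaussianOf (by simp)]
  calc ∫ x, gaussDensity (0, 1) x * (bumpMass γ σ x * (x - γ) ^ 2)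
      ≤ ∫ x, (2 * Real.exp (1 / 2) * Real.exp 2 * Real.exp (-γ ^ 2 / 2) * (2 * σ)) *
        (gaussDensity (γ, (2 * σ) ^ 2) x * (x - γ) ^ 2) := by
        refine integral_mono hi (hj.const_mul _) fun x => ?_
        have hb := bumpMass_le_exp hσ γ x
        have h3 : Real.exp (-x ^ 2 / 2) * Real.exp (-(x - γ) ^ 2 / (4 * σ ^ 2)) ≤
            Real.exp 2 * Real.exp (-γ ^ 2 / 2) *
              Real.exp (-(x - γ) ^ 2 / (2 * (2 * σ) ^ 2)) := by
          rw [← Real.exp_add, ← Real.exp_add, ← Real.exp_add]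
          apply Real.exp_le_exp.2
          have hγ' : γ = 1 / σ := by field_simp; linarith
          set u := (x - γ) * γ with hu
          have e1 : -(x - γ) ^ 2 / (4 * σ ^ 2) = -(u ^ 2) / 4 := by
            rw [hu, hγ']; field_simp
          have e2 : -(x - γ) ^ 2 / (2 * (2 * σ) ^ 2) = -(u ^ 2) / 8 := by
            rw [hu, hγ']; field_simp; ring
          rw [e1, e2]
          have e3 : -x ^ 2 / 2 = -γ ^ 2 / 2 - u - (x - γ) ^ 2 / 2 := by rw [hu]; ring
          rw [e3]
          -- Completing the square, `-u - u^2/4 ≤ 2 - u^2/8`; the product is thus dominated by a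
          -- Gaussian at `γ` with standard deviation `2 * σ`.
          nlinarith [sq_nonneg (u + 4), sq_nonneg (x - γ)]
        have h4 : gaussDensity (0, 1) x * bumpMass γ σ x ≤
            (2 * Real.exp (1 / 2) * Real.exp 2 * Real.exp (-γ ^ 2 / 2) * (2 * σ)) *
              gaussDensity (γ, (2 * σ) ^ 2) x := by
          rw [gaussDensity_zero_one, gaussDensity]
          simp only [sqrt_two_pi_mul_sq (by positivity : 0 < 2 * σ)]
          calc _ ≤ (Real.sqrt (2 * Real.pi))⁻¹ * Real.exp (-x ^ 2 / 2) *
                (2 * Real.exp (1 / 2) * Real.exp (-(x - γ) ^ 2 / (4 * σ ^ 2))) :=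
                mul_le_mul_of_nonneg_left hb (by positivity)
            _ = (Real.sqrt (2 * Real.pi))⁻¹ * (2 * Real.exp (1 / 2)) * (Real.exp (-x ^ 2 / 2) *
                Real.exp (-(x - γ) ^ 2 / (4 * σ ^ 2))) := by ring
            _ ≤ _ := mul_le_mul_of_nonneg_left h3 (by positivity)
            _ = _ := by field_simp
        calc _ = gaussDensity (0, 1) x * bumpMass γ σ x * (x - γ) ^ 2 := by ring
          _ ≤ _ := mul_le_mul_of_nonneg_right h4 (sq_nonneg _)
          _ = _ := by ring
    _ = 16 * Real.exp (1 / 2) * Real.exp 2 * σ * Real.exp (-γ ^ 2 / 2) * σ ^ 2 := by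
        rw [integral_const_mul, hq]; ring
    _ ≤ _ := mul_le_of_le_one_right (by positivity) (pow_le_one₀ hσ.le hσ1)

/-! ### Targets with prescribed Hessian, and sharpness of the rate. -/

theorem integrable_exp_linear_sub_sq {α : ℝ} (hα : 0 < α) (k d : ℝ) :
    Integrable fun x => Real.exp (k + d * x - α / 2 * x ^ 2) := by
  have hg : ExpGrowth fun x => Real.exp (k + d * x) := by
    refine ⟨by fun_prop, Real.exp k, |d|, (Real.exp_pos _).le, abs_nonneg _, fun x => ?_⟩
    rw [abs_of_pos (Real.exp_pos _), ← Real.exp_add, ← abs_mul]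
    exact Real.exp_le_exp.2 (by linarith [le_abs_self (d * x)])
  have hpos : 0 < ((0, 1 / α) : ℝ × ℝ).2 := by simp only; positivity
  have hs : 0 < Real.sqrt (2 * Real.pi * (1 / α)) := Real.sqrt_pos.2 (by positivity)
  refine ((hg.integrable_density hpos).const_mul (Real.sqrt (2 * Real.pi * (1 / α)))).congr
    (ae_of_all _ fun x => ?_)
  simp only [gaussDensity]
  rw [← mul_assoc, ← mul_assoc, mul_inv_cancel₀ hs.ne', one_mul, ← Real.exp_add]
  congr 1
  field_simp
  ring

/-- Every continuous function between `α` and `β` is the negative log-Hessian of a target whose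
score is centred under a given Gaussian. -/
theorem exists_isLogConcaveTarget {H : ℝ → ℝ} {α β : ℝ} (hH : Continuous H) (hα : 0 < α)
    (hlo : ∀ x, α ≤ H x) (hup : ∀ x, H x ≤ β) (a : ℝ × ℝ) :
    ∃ ρ : ℝ → ℝ, IsLogConcaveTarget ρ α β ∧
      (∀ θ, -deriv (deriv fun x => Real.log (ρ x)) θ = H θ) ∧
      ∫ θ, deriv (fun x => Real.log (ρ x)) θ ∂(gaussianOf a) = 0 := by
  set I : ℝ → ℝ := fun x => ∫ t in (0 : ℝ)..x, H t with hI
  have hI' : ∀ x, HasDerivAt I (H x) x := fun x =>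
    intervalIntegral.integral_hasDerivAt_right (hH.intervalIntegrable _ _)
      hH.aestronglyMeasurable.stronglyMeasurableAtFilter hH.continuousAt
  have hHg : ExpGrowth H := (ExpGrowth.const β).mono hH.measurable fun x => by
    have h1 := hlo x
    have h2 := hup x
    rwa [abs_of_nonneg (by linarith), abs_of_nonneg (by linarith)]
  have hIg : ExpGrowth I := .of_hasDerivAt hI' hHg
  -- The integration constant of the score is the Gaussian mean of `I`, which makes the score
  -- centred.
  set f1 : ℝ → ℝ := fun x => ∫ y, I y ∂(gaussianOf a) - I x with hf1
  have hf1' : ∀ x, HasDerivAt f1 (-H x) x := fun x => (hI' x).const_sub _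
  have hf1c : Continuous f1 := continuous_iff_continuousAt.2 fun x => (hf1' x).continuousAt
  set f : ℝ → ℝ := fun x => ∫ t in (0 : ℝ)..x, f1 t with hf
  have hf' : ∀ x, HasDerivAt f (f1 x) x := fun x =>
    intervalIntegral.integral_hasDerivAt_right (hf1c.intervalIntegrable _ _)
      hf1c.aestronglyMeasurable.stronglyMeasurableAtFilter hf1c.continuousAt
  have hfc : Continuous f := continuous_iff_continuousAt.2 fun x => (hf' x).continuousAt
  have hint : Integrable fun x => Real.exp (f x) := by
    refine (integrable_exp_linear_sub_sq hα (f 0) (f1 0)).mono'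
      (by fun_prop) (ae_of_all _ fun x => ?_)
    rw [Real.norm_eq_abs, Real.abs_exp]
    have := le_of_deriv2_le hf' hf1' (fun x => neg_le_neg (hlo x)) 0 x
    rw [sub_zero] at this
    exact Real.exp_le_exp.2 this
  set Z := ∫ x, Real.exp (f x) with hZ
  have hZ0 : 0 < Z := integral_exp_pos hint
  have hlog : (fun x => Real.log (Real.exp (f x) / Z)) = fun x => f x - Real.log Z := by
    funext x
    rw [Real.log_div (Real.exp_pos _).ne' hZ0.ne', Real.log_exp]
  have hd1 : deriv (fun x => Real.log (Real.exp (f x) / Z)) = f1 := by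
    rw [hlog]
    funext x
    exact ((hf' x).sub_const _).deriv
  have hd2 : deriv (deriv fun x => Real.log (Real.exp (f x) / Z)) = fun x => -H x := by
    rw [hd1]
    funext x
    exact (hf1' x).deriv
  have hdf1 : deriv f1 = fun x => -H x := funext fun x => (hf1' x).deriv
  have hdf : deriv f = f1 := funext fun x => (hf' x).deriv
  have hc1 : ContDiff ℝ 1 f1 := by
    rw [contDiff_one_iff_deriv, hdf1]
    exact ⟨fun x => (hf1' x).differentiableAt, hH.neg⟩
  have hc2 : ContDiff ℝ 2 f := by
    rw [show (2 : WithTop ℕ∞) = 1 + 1 by norm_num, contDiff_succ_iff_deriv, hdf]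
    exact ⟨fun x => (hf' x).differentiableAt, by simp, hc1⟩
  refine ⟨fun x => Real.exp (f x) / Z, ⟨fun x => by positivity, ?_, ?_, hα, ?_, ?_⟩, ?_, ?_⟩
  · rw [integral_div, ← hZ, div_self hZ0.ne']
  · rw [hlog]
    exact hc2.sub contDiff_const
  · rw [hd2]; simpa using hlo
  · rw [hd2]; simpa using hup
  · rw [hd2]; simp
  · rw [hd1, hf1, integral_sub (integrable_const _) (hIg.integrable_gaussianOf a)]
    simp

/-- For a bump of width `1 / γ` at `γ`, the ratio of its second moment around `γ` to its mass, and
the growth of minus the logarithm of its mass, under the standard Gaussian. -/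
theorem exists_bumpMass_bounds : ∃ K : ℝ, 1 ≤ K ∧ ∀ γ σ : ℝ, 0 < σ → σ ≤ 1 → γ * σ = 1 →
    0 < ∫ x, bumpMass γ σ x ∂(gaussianOf (0, 1)) ∧
    ∫ x, bumpMass γ σ x ∂(gaussianOf (0, 1)) ≤ 1 ∧
    ∫ x, bumpMass γ σ x * (x - γ) ^ 2 ∂(gaussianOf (0, 1)) ≤
      K * ∫ x, bumpMass γ σ x ∂(gaussianOf (0, 1)) ∧
    -Real.log (∫ x, bumpMass γ σ x ∂(gaussianOf (0, 1))) ≤ K * γ ^ 2 := by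
  have hs := one_le_sqrt_two_pi
  set c := 2 * (2 * (Real.sqrt (2 * Real.pi))⁻¹ * Real.exp (-2)) *
      ((Real.sqrt (2 * Real.pi))⁻¹ * Real.exp (-(3 / 2))) with hc
  set C := 16 * Real.exp (1 / 2) * Real.exp 2 with hC
  have hc0 : 0 < c := by positivity
  have hC0 : 0 < C := by positivity
  -- `C / c` compares the second moment with the mass; the remaining summands absorb `-log c + log γ
  -- + γ^2 / 2`, using `γ ≥ 1`.
  refine ⟨C / c + |Real.log c| + 2, ?_, fun γ σ hσ hσ1 hγσ => ?_⟩
  · have : 0 < C / c := by positivity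
    linarith [abs_nonneg (Real.log c)]
  have hγ : 1 ≤ γ := by
    by_contra hn
    nlinarith
  have hlo := le_integral_bumpMass hσ hσ1 hγσ
  have hup := integral_bumpMass_mul_sq_le hσ hσ1 hγσ
  rw [← hc] at hlo
  rw [← hC] at hup
  set P := ∫ x, bumpMass γ σ x ∂(gaussianOf (0, 1)) with hP
  have hlo0 : 0 < c * σ * Real.exp (-γ ^ 2 / 2) := by positivity
  have hP0 : 0 < P := hlo0.trans_le hlo
  refine ⟨hP0, ?_, ?_, ?_⟩
  · have := integral_mono ((expGrowth_bumpMass hσ γ).integrable_gaussianOf (0, 1))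
      (integrable_const (1 : ℝ)) fun x => bumpMass_le_one γ σ x
    simpa using this
  · calc _ ≤ _ := hup
      _ = C / c * (c * σ * Real.exp (-γ ^ 2 / 2)) := by field_simp
      _ ≤ C / c * P := mul_le_mul_of_nonneg_left hlo (by positivity)
      _ ≤ _ := mul_le_mul_of_nonneg_right (by linarith [abs_nonneg (Real.log c)]) hP0.le
  · have h1 := Real.log_le_log hlo0 hlo
    rw [Real.log_mul (by positivity) (Real.exp_pos _).ne', Real.log_mul hc0.ne' hσ.ne',
      Real.log_exp] at h1
    have h2 : Real.log σ = -Real.log γ := by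
      rw [← Real.log_inv]; congr 1; exact eq_inv_of_mul_eq_one_right hγσ
    have h3 : Real.log γ ≤ γ - 1 := Real.log_le_sub_one_of_pos (by linarith)
    have h4 : γ ≤ γ ^ 2 := by nlinarith
    have h5 : |Real.log c| ≤ |Real.log c| * γ ^ 2 :=
      le_mul_of_one_le_right (abs_nonneg _) (by nlinarith)
    have h6 : 0 ≤ C / c * γ ^ 2 := by positivity
    have h7 := neg_abs_le (Real.log c)
    nlinarith

/-- The targets whose log-Hessian is a smoothed bump of width `1 / γ` at `γ` saturate the
convergence rate bound, uniformly in `γ`. -/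
theorem exists_bump_target : ∃ K : ℝ, ∀ γ : ℝ, 2 ≤ γ → ∃ (ρ : ℝ → ℝ) (β l : ℝ),
    IsLogConcaveTarget ρ (1 / γ ^ 2) β ∧ 1 / γ ^ 2 < β ∧
    (∀ θ, -deriv (deriv fun x => Real.log (ρ x)) θ = smoothedBump (1 / γ ^ 2) β γ (1 / γ) θ) ∧
    γ ^ 2 ≤ β / (1 / γ ^ 2) ∧ IsGaussianVIMinimizer ρ (0, 1) ∧
    IsTopJacobianEigenvalue ρ (0, 1) l ∧ 0 < -l ∧
    -l ≤ K * (1 / Real.log (β / (1 / γ ^ 2))) := by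
  obtain ⟨K, hK1, hK⟩ := exists_bumpMass_bounds
  refine ⟨4 * (3 + K) ^ 2 * (K + 2), fun γ hγ => ?_⟩
  have hγ0 : 0 < γ := by linarith
  have hσ : 0 < 1 / γ := by positivity
  obtain ⟨hP0, hP1, hN, hlogP⟩ := hK γ (1 / γ) hσ
    (by rw [div_le_one hγ0]; linarith) (by field_simp)
  set P := ∫ x, bumpMass γ (1 / γ) x ∂(gaussianOf (0, 1)) with hP
  set N := ∫ x, bumpMass γ (1 / γ) x * (x - γ) ^ 2 ∂(gaussianOf (0, 1)) with hNdef
  -- With this floor the background contributes only `α * (γ^2 + 1) ≤ 2` to the second moment around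
  -- `γ`.
  set α := 1 / γ ^ 2 with hα
  have hα0 : 0 < α := by positivity
  have hαγ : α * γ ^ 2 = 1 := by rw [hα]; field_simp
  have hα1 : α < 1 := by
    rw [hα, div_lt_one (by positivity)]; nlinarith
  -- Forced by `α + (β - α) * P = 1`, the stationarity condition in the variance at `C = 1`.
  set β := α + (1 - α) / P with hβ
  have hβP : (β - α) * P = 1 - α := by rw [hβ]; field_simp; ring
  have hβα : α < β := by
    have : 0 < (1 - α) / P := div_pos (by linarith) hP0
    linarith
  have hbg := expGrowth_bumpMass hσ γ
  set H : ℝ → ℝ := fun θ => α + (β - α) * bumpMass γ (1 / γ) θ with hH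
  have hHg : ExpGrowth H := (ExpGrowth.const _).add (hbg.const_mul _)
  obtain ⟨ρ, hρ, hess, h1⟩ := exists_isLogConcaveTarget (H := H) (α := α) (β := β)
    (continuous_const.add (continuous_const.mul (continuous_bumpMass hσ γ))) hα0
    (fun x => by
      have := mul_nonneg (sub_nonneg.2 hβα.le) (bumpMass_nonneg γ (1 / γ) x)
      simp only [hH]; linarith)
    (fun x => by
      have := mul_le_of_le_one_right (sub_nonneg.2 hβα.le) (bumpMass_le_one γ (1 / γ) x)
      simp only [hH]; linarith) (0, 1)
  have h01 : (0 : ℝ) < ((0, 1) : ℝ × ℝ).2 := one_pos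
  have hHint : ∫ x, H x ∂(gaussianOf (0, 1)) = 1 := by
    simp only [hH]
    rw [integral_add (integrable_const _) ((hbg.const_mul _).integrable_gaussianOf _),
      integral_const_mul, ← hP, hβP]
    simp
  have h2 : ((0, 1) : ℝ × ℝ).2 * ∫ θ, deriv (deriv fun x => Real.log (ρ x)) θ
      ∂(gaussianOf (0, 1)) = -1 := by
    have e : deriv (deriv fun x => Real.log (ρ x)) = fun θ => -H θ :=
      funext fun θ => by linarith [hess θ]
    rw [e, integral_neg, hHint]; norm_num
  -- Centring the variance bound at `γ` avoids computing the weighted mean.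
  obtain ⟨l, hl, hlo, hup⟩ := hρ.exists_isTopJacobianEigenvalue h01 h1 h2 rfl γ
  simp only [hess, sub_zero] at hlo hup
  set S := ∫ θ, H θ * θ ^ 2 ∂(gaussianOf (0, 1)) with hS
  set v := ∫ θ, H θ * (θ - γ) ^ 2 ∂(gaussianOf (0, 1)) with hv
  have gq : ExpGrowth fun x => (x - γ) ^ 2 := (ExpGrowth.sub_const _).pow 2
  have hHpos : ∀ x, 0 ≤ H x := fun x =>
    add_nonneg hα0.le (mul_nonneg (sub_nonneg.2 hβα.le) (bumpMass_nonneg γ (1 / γ) x))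
  have hvle : v ≤ 2 + K := by
    have e : (fun θ => H θ * (θ - γ) ^ 2) = fun θ => α * (-γ + 1 * (θ - ((0, 1) : ℝ × ℝ).1)) ^ 2 +
        (β - α) * (bumpMass γ (1 / γ) θ * (θ - γ) ^ 2) := by
      funext θ; simp only [hH]; ring
    have k1 : ExpGrowth fun θ => α * (-γ + 1 * (θ - ((0, 1) : ℝ × ℝ).1)) ^ 2 :=
      (((ExpGrowth.const _).add ((ExpGrowth.sub_const _).const_mul _)).pow 2).const_mul _
    rw [hv, e, integral_add (k1.integrable_gaussianOf _)
      (((hbg.mul gq).const_mul _).integrable_gaussianOf _), integral_const_mul,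
      integral_const_mul, integral_affine_sq h01, ← hNdef]
    have h3 : (β - α) * N ≤ (β - α) * (K * P) :=
      mul_le_mul_of_nonneg_left hN (sub_nonneg.2 hβα.le)
    have h4 : (β - α) * (K * P) = K * (1 - α) := by rw [← hβP]; ring
    simp only
    nlinarith
  have hv0 : 0 ≤ v := integral_nonneg fun θ => mul_nonneg (hHpos θ) (sq_nonneg _)
  have hS0 : 0 ≤ S := integral_nonneg fun θ => mul_nonneg (hHpos θ) (sq_nonneg _)
  have hSv : γ ^ 2 / 2 ≤ S + v := by
    have k2 : ExpGrowth fun θ => H θ * θ ^ 2 := hHg.mul (ExpGrowth.id.pow 2)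
    rw [hS, hv, ← integral_add (k2.integrable_gaussianOf _) ((hHg.mul gq).integrable_gaussianOf _)]
    have e : γ ^ 2 / 2 = ∫ θ, γ ^ 2 / 2 * H θ ∂(gaussianOf (0, 1)) := by
      rw [integral_const_mul, hHint, mul_one]
    rw [e]
    refine integral_mono ((hHg.const_mul _).integrable_gaussianOf _)
      ((k2.add (hHg.mul gq)).integrable_gaussianOf _) fun θ => ?_
    -- This is `θ^2 + (θ - γ)^2 ≥ γ^2 / 2`: bounded spread around `γ` forces a large second moment
    -- around `0`.
    have : 0 ≤ H θ * (2 * θ - γ) ^ 2 := mul_nonneg (hHpos θ) (sq_nonneg _)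
    simp only
    nlinarith
  have hκ : β / α = 1 + (1 - α) * γ ^ 2 / P := by
    rw [hβ, add_div, div_self hα0.ne', hα]; field_simp
  have hκγ : γ ^ 2 ≤ β / α := by
    rw [hκ]
    have h3 : (1 - α) * γ ^ 2 ≤ (1 - α) * γ ^ 2 / P :=
      le_div_self (mul_nonneg (by linarith) (sq_nonneg _)) hP0 hP1
    linarith
  have hlogpos : 0 < Real.log (β / α) := Real.log_pos (by nlinarith)
  have hlogκ : Real.log (β / α) ≤ (K + 2) * γ ^ 2 := by
    have h3 : β / α ≤ γ ^ 2 / P := by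
      rw [hκ, ← sub_nonneg]
      have : γ ^ 2 / P - (1 + (1 - α) * γ ^ 2 / P) = (1 - P) / P := by
        field_simp; linarith
      rw [this]
      exact div_nonneg (by linarith) hP0.le
    have h4 := Real.log_le_log (by positivity) h3
    rw [Real.log_div (by positivity) hP0.ne', Real.log_pow] at h4
    have h5 : Real.log γ ≤ γ - 1 := Real.log_le_sub_one_of_pos hγ0
    push_cast at h4
    nlinarith
  have h3S : 0 < 3 + S := by linarith
  refine ⟨ρ, β, l, hρ, hβα, fun θ => by rw [hess, smoothedBump_eq hσ], hκγ,
    hρ.isGaussianVIMinimizer_of_stationary h01 h1 h2, hl, ?_, ?_⟩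
  · exact lt_of_lt_of_le (by positivity) hlo
  · calc -l ≤ 2 * ((1 + v) / (3 + S)) := hup
      _ ≤ 2 * ((3 + K) / (3 + S)) := by gcongr 2 * (?_ / _); linarith
      _ ≤ 2 * ((3 + K) * (2 * (3 + K) / γ ^ 2)) := by
          rw [div_eq_mul_one_div (3 + K)]
          gcongr 2 * ((3 + K) * ?_)
          rw [div_le_div_iff₀ h3S (by positivity)]
          nlinarith
      _ = 4 * (3 + K) ^ 2 * (1 / γ ^ 2) := by ring
      _ ≤ 4 * (3 + K) ^ 2 * ((K + 2) * (1 / Real.log (β / α))) := by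
          gcongr
          rw [mul_one_div, div_le_div_iff₀ (by positivity) hlogpos]
          linarith
      _ = _ := by ring

theorem mainTheorem10 :
    (∀ (ρ : ℝ → ℝ) (α β : ℝ), IsLogConcaveTarget ρ α β →
      (∃! a : ℝ × ℝ, IsGaussianVIMinimizer ρ a) ∧
      ∀ a : ℝ × ℝ, IsGaussianVIMinimizer ρ a →
        ∃ l : ℝ, IsTopJacobianEigenvalue ρ a l ∧ l < 0 ∧
          -l ≥ 1 / ((7 + 4 / Real.sqrt Real.pi) * (1 + Real.log (β / α)))) ∧
    (∃ (ρ : ℕ → ℝ → ℝ) (α β γ σ : ℕ → ℝ) (a : ℕ → ℝ × ℝ) (l : ℕ → ℝ),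
      (∀ n, IsLogConcaveTarget (ρ n) (α n) (β n)) ∧
      (∀ n, α n < β n ∧ 0 < γ n ∧ 0 < σ n) ∧
      (∀ n θ, -deriv (deriv (fun x => Real.log (ρ n x))) θ =
        smoothedBump (α n) (β n) (γ n) (σ n) θ) ∧
      Tendsto σ atTop (nhds 0) ∧
      Tendsto (fun n => β n / α n) atTop atTop ∧
      (∀ n, IsGaussianVIMinimizer (ρ n) (a n)) ∧
      (∀ n, IsTopJacobianEigenvalue (ρ n) (a n) (l n)) ∧
      Asymptotics.IsBigO atTop (fun n => -l n) (fun n => 1 / Real.log (β n / α n))) := by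
  refine ⟨fun ρ α β h => ⟨h.existsUnique_isGaussianVIMinimizer,
    fun a ha => h.exists_isTopJacobianEigenvalue_ge ha⟩, ?_⟩
  obtain ⟨K, hK⟩ := exists_bump_target
  have hγ : ∀ n : ℕ, (2 : ℝ) ≤ n + 2 := fun n => by linarith [n.cast_nonneg (α := ℝ)]
  choose ρ β l h1 h2 h3 h4 h5 h6 h7 h8 using fun n : ℕ => hK (n + 2) (hγ n)
  have hto : Tendsto (fun n : ℕ => (n : ℝ) + 2) atTop atTop :=
    tendsto_atTop_add_const_right _ _ tendsto_natCast_atTop_atTop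
  refine ⟨ρ, fun n => 1 / ((n : ℝ) + 2) ^ 2, β, fun n => (n : ℝ) + 2, fun n => 1 / ((n : ℝ) + 2),
    fun _ => (0, 1), l, h1, fun n => ⟨h2 n, by positivity, by positivity⟩, h3, ?_, ?_, h5, h6, ?_⟩
  · simp only [one_div]
    exact tendsto_inv_atTop_zero.comp hto
  · refine tendsto_atTop_mono (fun n => ?_) hto
    exact le_trans (by nlinarith [hγ n]) (h4 n)
  · refine Asymptotics.IsBigO.of_bound K (Eventually.of_forall fun n => ?_)
    have hpos : 0 ≤ 1 / Real.log (β n / (1 / ((n : ℝ) + 2) ^ 2)) :=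
      one_div_nonneg.2 (Real.log_nonneg (le_trans (by nlinarith [hγ n]) (h4 n)))
    rw [Real.norm_of_nonneg (h7 n).le, Real.norm_of_nonneg hpos]
    exact h8 n
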